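/- All spaces are real. Let $E$ be a \emph{convenient vector space}, i.e. a Hausdorff locally convex space in which every Mackey--Cauchy sequence converges. A curve $c:\mathbb R\to E$ is smooth if all its derivatives exist, and the $c^\infty$-topology on $E$ is the final topology with respect to all smooth curves. For a $c^\infty$-open set $U\subseteq E$ let $C^\infty(U,\mathbb R)$ be the space of functions $f$ on $U$ such that $f\circ c$ is smooth for every smooth curve $c:\mathbb R\to E$ with values in $U$; a subset of it is bounded if, along each such $c$, each derivative $(f\circ c)^{(k)}$ is bounded on compact sets, uniformly in $f$. Let $L(E,F)$ be the space of bounded linear maps, in which a set is bounded if it is uniformly bounded on each bounded subset of $E$; put $E'=L(E,\mathbb R)$ and $E''=L(E',\mathbb R)$. Call $E$ \emph{reflexive} if the canonical map $E\to E''$ is surjective. Say that $E$ has the \emph{bornological approximation property} if (the image of) $E'\otimes E$ is dense in $L(E,E)$ for the locally convex topology given by all seminorms that are bounded on bounded sets. For $a\in E$ let $C^\infty_a(E,\mathbb R)$ be the space of germs at $a$ of smooth functions defined on $c^\infty$-open neighbourhoods of $a$. Let $D_aE$, the space of \emph{operational tangent vectors} at $a$, be the space of all linear maps $\partial:C^\infty_a(E,\mathbb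 R)\to\mathbb R$ with $\partial(fg)=\partial(f)\,g(a)+f(a)\,\partial(g)$ that induce a bounded functional on $C^\infty(U,\mathbb R)$ for every $c^\infty$-open neighbourhood $U$ of $a$. It carries the bornology of a subspace of $\prod_U L(C^\infty(U,\mathbb R),\mathbb R)$. Let $D^{(1)}_aE$ be the set of $\partial\in D_aE$ of the form $\partial(f)=Y(df(a))$ with $Y\in E''$, where $df(a)\in E'$ is $df(a)(v)=\frac{d}{dt}\big|_{t=0}f(a+tv)$. \textbf{Theorem.} Suppose that the convenient vector space $E$ has the bornological approximation property, and let $a\in E$. Then $D_aE=D^{(1)}_aE$, and $Y\mapsto\big(f\mapsto Y(df(a))\big)$ is a linear isomorphism $E''\cong D_aE$ which is bounded in both directions. If $E$ is in addition reflexive, then every operational tangent vector at $a$ is kinematic; more precisely, $X\mapsto\big(f\mapsto df(a)(X)\big)$ is a linear isomorphism $E=T_aE\cong D_aE$ which is bounded in both directions. -/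

import Mathlib

open Filter Topology
open scoped ContDiff

namespace ConvenientCalculus

section Spaces

variable (E : Type*) [AddCommGroup E] [Module ℝ E] [TopologicalSpace E]

/-- A sequence is Mackey-Cauchy if `rₙₘ • (xₙ - xₘ)` stays bounded for some positive
real numbers `rₙₘ` tending to infinity as `n, m → ∞`. -/
def IsMackeyCauchy {E : Type*} [AddCommGroup E] [Module ℝ E] [TopologicalSpace E]
    (x : ℕ → E) : Prop :=
  ∃ r : ℕ × ℕ → ℝ, (∀ p, 0 < r p) ∧ Tendsto r atTop atTop ∧
    Bornology.IsVonNBounded ℝ (Set.range fun p : ℕ × ℕ => r p • (x p.1 - x p.2))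

/-- A (Hausdorff locally convex) space is convenient, i.e. `c^∞`-complete, if every
Mackey-Cauchy sequence converges. -/
def IsConvenient : Prop :=
  ∀ x : ℕ → E, IsMackeyCauchy x → ∃ l : E, Tendsto x atTop (𝓝 l)

/-- A curve is smooth if all its iterated derivatives `d n` exist (they are then
continuous, being differentiable). -/
def IsSmoothCurve {E : Type*} [AddCommGroup E] [Module ℝ E] [TopologicalSpace E]
    [ContinuousSMul ℝ E] (c : ℝ → E) : Prop :=
  ∃ d : ℕ → ℝ → E, d 0 = c ∧ ∀ (n : ℕ) (t : ℝ), HasDerivAt (d n) (d (n + 1) t) t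

/-- The `c^∞`-topology: the final topology with respect to all smooth curves. -/
@[reducible] def cInftyTopology [ContinuousSMul ℝ E] : TopologicalSpace E :=
  ⨆ c : {c : ℝ → E // IsSmoothCurve c}, TopologicalSpace.coinduced c.1 inferInstance

/-- `U` is a `c^∞`-open neighbourhood of `a`. -/
def IsCInftyNhd {E : Type*} [AddCommGroup E] [Module ℝ E] [TopologicalSpace E]
    [ContinuousSMul ℝ E] (a : E) (U : Set E) : Prop :=
  IsOpen[cInftyTopology E] U ∧ a ∈ U

theorem IsCInftyNhd.inter {E : Type*} [AddCommGroup E] [Module ℝ E] [TopologicalSpace E]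
    [ContinuousSMul ℝ E] {a : E} {U V : Set E} (hU : IsCInftyNhd a U) (hV : IsCInftyNhd a V) :
    IsCInftyNhd a (U ∩ V) :=
  ⟨(cInftyTopology E).isOpen_inter U V hU.1 hV.1, hU.2, hV.2⟩

end Spaces

section BoundedMaps

/-- The space `L(E, F)` of bounded linear maps: those mapping bounded sets to bounded sets. -/
def BoundedLinear (E F : Type*) [AddCommGroup E] [Module ℝ E] [TopologicalSpace E]
    [AddCommGroup F] [Module ℝ F] [TopologicalSpace F] [IsTopologicalAddGroup F]
    [ContinuousSMul ℝ F] : Submodule ℝ (E →ₗ[ℝ] F) where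
  carrier := {T | ∀ B : Set E, Bornology.IsVonNBounded ℝ B → Bornology.IsVonNBounded ℝ (T '' B)}
  zero_mem' := by
    intro B _
    refine (Bornology.isVonNBounded_singleton (𝕜 := ℝ) (0 : F)).subset ?_
    rintro _ ⟨x, _, rfl⟩
    simp
  add_mem' := by
    intro S T hS hT B hB
    refine ((hS B hB).add (hT B hB)).subset ?_
    rintro _ ⟨x, hx, rfl⟩
    exact Set.add_mem_add ⟨x, hx, rfl⟩ ⟨x, hx, rfl⟩
  smul_mem' := by
    intro r T hT B hB
    refine ((hT B hB).image (r • ContinuousLinearMap.id ℝ F)).subset ?_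
    rintro _ ⟨x, hx, rfl⟩
    exact ⟨T x, ⟨x, hx, rfl⟩, by simp⟩

/-- The dual `E' = L(E, ℝ)` of bounded linear functionals. -/
abbrev BDual (E : Type*) [AddCommGroup E] [Module ℝ E] [TopologicalSpace E] :
    Submodule ℝ (E →ₗ[ℝ] ℝ) :=
  BoundedLinear E ℝ

/-- The bounded subsets of `L(E, F)`: uniformly bounded on each bounded subset of `E`. -/
def IsBoundedMaps {E F : Type*} [AddCommGroup E] [Module ℝ E] [TopologicalSpace E]
    [AddCommGroup F] [Module ℝ F] [TopologicalSpace F] [IsTopologicalAddGroup F]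
    [ContinuousSMul ℝ F] (H : Set (BoundedLinear E F)) : Prop :=
  ∀ B : Set E, Bornology.IsVonNBounded ℝ B →
    Bornology.IsVonNBounded ℝ {y : F | ∃ T ∈ H, ∃ x ∈ B, y = T.1 x}

/-- The bidual `E'' = L(E', ℝ)`. -/
def BBidual (E : Type*) [AddCommGroup E] [Module ℝ E] [TopologicalSpace E] :
    Submodule ℝ (BDual E →ₗ[ℝ] ℝ) where
  carrier := {Y | ∀ H : Set (BDual E), IsBoundedMaps H → Bornology.IsBounded (Y '' H)}
  zero_mem' := by
    intro H _
    refine (Bornology.isBounded_singleton (x := (0 : ℝ))).subset ?_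
    rintro _ ⟨x, _, rfl⟩
    simp
  add_mem' := by
    intro S T hS hT H hH
    refine (Bornology.IsBounded.add (hS H hH) (hT H hH)).subset ?_
    rintro _ ⟨x, hx, rfl⟩
    exact Set.add_mem_add ⟨x, hx, rfl⟩ ⟨x, hx, rfl⟩
  smul_mem' := by
    intro r T hT H hH
    refine (Bornology.IsBounded.smul₀ (hT H hH) r).subset ?_
    rintro _ ⟨x, hx, rfl⟩
    exact ⟨T x, ⟨x, hx, rfl⟩, by simp⟩

/-- The bounded subsets of the bidual: uniformly bounded on each bounded subset of `E'`. -/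
def IsBoundedInBidual {E : Type*} [AddCommGroup E] [Module ℝ E] [TopologicalSpace E]
    (S : Set (BBidual E)) : Prop :=
  ∀ H : Set (BDual E), IsBoundedMaps H →
    Bornology.IsBounded {r : ℝ | ∃ Y ∈ S, ∃ φ ∈ H, r = Y.1 φ}

/-- `E` is reflexive: every element of `E''` is evaluation at a point of `E`. -/
def IsBReflexive (E : Type*) [AddCommGroup E] [Module ℝ E] [TopologicalSpace E] : Prop :=
  ∀ Y : BBidual E, ∃ X : E, ∀ φ : BDual E, Y.1 φ = φ.1 X

/-- The bornological locally convex topology determined by a family of bounded sets: the one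
defined by all seminorms that are bounded on each of these sets. -/
@[reducible] noncomputable def bornologicalTopology {X : Type*} [AddCommGroup X] [Module ℝ X] (bdd : Set X → Prop) :
    TopologicalSpace X :=
  (SeminormFamily.moduleFilterBasis
    (fun p : {p : Seminorm ℝ X // ∀ H : Set X, bdd H → BddAbove (p '' H)} => p.1)).topology

/-- The image of `E' ⊗ E` in `L(E, E)`: the span of the maps `x ↦ φ x • y`. -/
def finiteRankMaps (E : Type*) [AddCommGroup E] [Module ℝ E] [TopologicalSpace E]
    [IsTopologicalAddGroup E] [ContinuousSMul ℝ E] : Submodule ℝ (BoundedLinear E E) :=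
  Submodule.span ℝ {T | ∃ (φ : BDual E) (y : E), ∀ x : E, T.1 x = φ.1 x • y}

/-- The bornological approximation property: `E' ⊗ E` is dense in `L(E, E)` for the
bornological locally convex topology. -/
def HasBornologicalApproximationProperty (E : Type*) [AddCommGroup E] [Module ℝ E]
    [TopologicalSpace E] [IsTopologicalAddGroup E] [ContinuousSMul ℝ E] : Prop :=
  @Dense (BoundedLinear E E) (bornologicalTopology IsBoundedMaps)
    (finiteRankMaps E : Set (BoundedLinear E E))

end BoundedMaps

section TangentVectors

variable {E : Type*} [AddCommGroup E] [Module ℝ E] [TopologicalSpace E] [ContinuousSMul ℝ E]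

/-- `f` is smooth on `U`: it maps smooth curves in `U` to smooth curves in `ℝ`. The elements of
`C^∞(U, ℝ)` are the restrictions to `U` of such functions (values outside `U` are irrelevant). -/
def IsSmoothOn (U : Set E) (f : E → ℝ) : Prop :=
  ∀ c : ℝ → E, IsSmoothCurve c → (∀ t, c t ∈ U) → ContDiff ℝ ∞ (f ∘ c)

/-- A bounded subset of `C^∞(U, ℝ)`: along each smooth curve in `U`, all derivatives are
uniformly bounded on compact sets. -/
def IsBoundedSmooth (U : Set E) (𝓕 : Set (E → ℝ)) : Prop :=
  (∀ f ∈ 𝓕, IsSmoothOn U f) ∧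
    ∀ c : ℝ → E, IsSmoothCurve c → (∀ t, c t ∈ U) → ∀ (k : ℕ) (K : Set ℝ), IsCompact K →
      Bornology.IsBounded {r : ℝ | ∃ f ∈ 𝓕, ∃ t ∈ K, r = iteratedDeriv k (f ∘ c) t}

/-- Germs at `a`, for the `c^∞`-topology, of arbitrary real functions. -/
abbrev GermAt (a : E) : Type _ := Filter.Germ (@nhds E (cInftyTopology E) a) ℝ

/-- The space `C^∞_a(E, ℝ)` of germs at `a` of smooth real functions. -/
def SmoothGerms (a : E) : Submodule ℝ (GermAt a) where
  carrier := {g | ∃ U : Set E, IsCInftyNhd a U ∧ ∃ f : E → ℝ, IsSmoothOn U f ∧ g = ↑f}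
  zero_mem' := by
    refine ⟨Set.univ, ⟨@isOpen_univ E (cInftyTopology E), trivial⟩, 0, ?_, rfl⟩
    intro c _ _
    exact contDiff_const
  add_mem' := by
    rintro _ _ ⟨U, hU, f, hf, rfl⟩ ⟨V, hV, g, hg, rfl⟩
    refine ⟨U ∩ V, hU.inter hV, f + g, ?_, rfl⟩
    intro c hc h
    exact (hf c hc fun t => (h t).1).add (hg c hc fun t => (h t).2)
  smul_mem' := by
    rintro r _ ⟨U, hU, f, hf, rfl⟩
    refine ⟨U, hU, r • f, ?_, rfl⟩
    intro c hc h
    exact (hf c hc h).const_smul r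

theorem SmoothGerms.mul_mem {a : E} {g h : GermAt a} (hg : g ∈ SmoothGerms a)
    (hh : h ∈ SmoothGerms a) : g * h ∈ SmoothGerms a := by
  obtain ⟨U, hU, f, hf, rfl⟩ := hg
  obtain ⟨V, hV, k, hk, rfl⟩ := hh
  refine ⟨U ∩ V, hU.inter hV, f * k, ?_, rfl⟩
  intro c hc h
  exact (hf c hc fun t => (h t).1).mul (hk c hc fun t => (h t).2)

/-- The evaluation `ev_a` of a smooth germ at its foot point. -/
def evalGerm {a : E} (g : SmoothGerms a) : ℝ :=
  @Filter.Germ.value E ℝ (cInftyTopology E) a g.1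

/-- The germ at `a` of a function that is smooth on a `c^∞`-open neighbourhood of `a`. -/
def germOf {a : E} {U : Set E} (hU : IsCInftyNhd a U) (f : E → ℝ) (hf : IsSmoothOn U f) :
    SmoothGerms a :=
  ⟨(f : GermAt a), U, hU, f, hf, rfl⟩

/-- The space `D_a E` of operational tangent vectors with foot point `a`: linear functionals on
`C^∞_a(E, ℝ)` that are derivations over `ev_a` and that are bounded, i.e. bounded on
(the image of) each bounded subset of `C^∞(U, ℝ)`, for each open neighbourhood `U` of `a`. -/
def OperationalTangent (a : E) : Submodule ℝ (SmoothGerms a →ₗ[ℝ] ℝ) where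
  carrier := {D |
    (∀ g h : SmoothGerms a,
      D ⟨g.1 * h.1, SmoothGerms.mul_mem g.2 h.2⟩ = D g * evalGerm h + evalGerm g * D h) ∧
    ∀ (U : Set E) (hU : IsCInftyNhd a U) (𝓕 : Set (E → ℝ)) (h𝓕 : IsBoundedSmooth U 𝓕),
      Bornology.IsBounded
        {r : ℝ | ∃ (f : E → ℝ) (hf : f ∈ 𝓕), r = D (germOf hU f (h𝓕.1 f hf))}}
  zero_mem' := by
    refine ⟨fun g h => by simp, fun U hU 𝓕 h𝓕 => ?_⟩
    refine (Bornology.isBounded_singleton (x := (0 : ℝ))).subset ?_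
    rintro _ ⟨f, hf, rfl⟩
    simp
  add_mem' := by
    rintro S T ⟨hS, hS'⟩ ⟨hT, hT'⟩
    refine ⟨fun g h => ?_, fun U hU 𝓕 h𝓕 => ?_⟩
    · rw [LinearMap.add_apply, LinearMap.add_apply, LinearMap.add_apply, hS, hT]
      ring
    · refine (Bornology.IsBounded.add (hS' U hU 𝓕 h𝓕) (hT' U hU 𝓕 h𝓕)).subset ?_
      rintro _ ⟨f, hf, rfl⟩
      exact Set.add_mem_add ⟨f, hf, rfl⟩ ⟨f, hf, rfl⟩
  smul_mem' := by
    rintro r T ⟨hT, hT'⟩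
    refine ⟨fun g h => ?_, fun U hU 𝓕 h𝓕 => ?_⟩
    · rw [LinearMap.smul_apply, LinearMap.smul_apply, LinearMap.smul_apply, hT]
      simp only [smul_eq_mul]
      ring
    · refine (Bornology.IsBounded.smul₀ (hT' U hU 𝓕 h𝓕) r).subset ?_
      rintro _ ⟨f, hf, rfl⟩
      exact ⟨_, ⟨f, hf, rfl⟩, by simp⟩

/-- The bounded subsets of `D_a E`, as a subspace of the product over all open neighbourhoods `U`
of `a` of the spaces `L(C^∞(U, ℝ), ℝ)`. -/
def IsBoundedTangent {a : E} (S : Set (OperationalTangent a)) : Prop :=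
  ∀ (U : Set E) (hU : IsCInftyNhd a U) (𝓕 : Set (E → ℝ)) (h𝓕 : IsBoundedSmooth U 𝓕),
    Bornology.IsBounded
      {r : ℝ | ∃ D ∈ S, ∃ (f : E → ℝ) (hf : f ∈ 𝓕), r = D.1 (germOf hU f (h𝓕.1 f hf))}

/-- `φ ∈ E'` is the differential `df(a)`: `φ v` is the derivative at `0` of `t ↦ f (a + t v)`. -/
def IsDifferential (f : E → ℝ) (a : E) (φ : BDual E) : Prop :=
  ∀ v : E, HasDerivAt (fun t : ℝ => f (a + t • v)) (φ.1 v) 0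

/-- `D` is the operational tangent vector `f ↦ Y (df(a))` given by `Y ∈ E''`. (The differential
`df(a)` is required to exist as an element of `E'`; it is then unique.) -/
def IsInducedBy {a : E} (D : OperationalTangent a) (Y : BBidual E) : Prop :=
  ∀ (U : Set E) (hU : IsCInftyNhd a U) (f : E → ℝ) (hf : IsSmoothOn U f),
    ∃ φ : BDual E, IsDifferential f a φ ∧ D.1 (germOf hU f hf) = Y.1 φ

/-- The space `D^{(1)}_a E` of operational tangent vectors of first order. -/
def FirstOrderTangent (a : E) : Set (OperationalTangent a) :=
  {D | ∃ Y : BBidual E, IsInducedBy D Y}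

/-- `D` is the operational tangent vector `f ↦ df(a)(X)` given by the kinematic tangent
vector `(a, X)`. -/
def IsKinematic {a : E} (D : OperationalTangent a) (X : E) : Prop :=
  ∀ (U : Set E) (hU : IsCInftyNhd a U) (f : E → ℝ) (hf : IsSmoothOn U f),
    HasDerivAt (fun t : ℝ => f (a + t • X)) (D.1 (germOf hU f hf)) 0

end TangentVectors

end ConvenientCalculus

namespace ConvenientCalculus

/-! ### Calculus of smooth curves in topological vector spaces -/

section Curves

set_option linter.unusedSectionVars false

variable {E : Type*} [AddCommGroup E] [Module ℝ E] [TopologicalSpace E]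
  [IsTopologicalAddGroup E] [ContinuousSMul ℝ E]

/-! Let `D` be an operational tangent vector at `a` and `f` smooth near `a`. On a star-shaped
`c^∞`-open neighbourhood of `a` the mean value formula gives `f x = f a + df(a)(x - a) + G x (x -
a)`, where `G x ∈ E'` is a weighted mean of the differentials of `f` over the segment from `a` to
`x`, minus `df(a)`; in particular `G a = 0`. Since `D` kills constants, everything hinges on its
killing the remainder.

To this end insert an operator: `Λ A = D (x ↦ G x (A (x - a)))` is a linear functional on `L(E, E)`.
On a rank-one operator `x ↦ φ x • y` it is `D` of the product of `φ (x - a)` and `G x y`, both of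
which vanish at `a`, so the Leibniz rule gives zero. Moreover `Λ` is bounded on bounded sets, so
`|Λ|` is one of the seminorms defining the bornological topology, and the approximation property
forces `Λ = 0` (`kernelFunctional_eq_zero`). Taking `A = id` shows `D f = D (df(a)(· - a))`
(`OperationalTangent.apply_germOf`). Thus `D` is induced by the functional `φ ↦ D (φ (· - a))` in
`E''`, and this assignment inverts `Y ↦ (f ↦ Y (df(a)))`.

The analysis rests on three tools. Smoothness is tested only along curves, so joint smoothness in
several real parameters comes from Boman's theorem (`contDiffAt_of_forall_curve`), proved by a curve
through a fast converging sequence and decay of Fourier transforms. Convenience of `E` enters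
through series `∑ 2⁻ⁿ bₙ vₙ` with `v` bounded (`exists_sumMap`), which yield smooth curves detecting
unboundedness. Boundedness of `Λ` (`IsSmoothKernel.isBoundedSmooth`) follows by summing a
hypothetical bad sequence of operators in the same way and applying Banach–Steinhaus on bounded
coefficient sequences.

For reflexive `E`, the Hahn–Banach theorem makes `E → E''` a bornological isomorphism. -/

theorem hasDerivAt_iff_tendsto_inv_smul_sub {c : ℝ → E} {c' : E} {t : ℝ} :
    HasDerivAt c c' t ↔ Tendsto (fun s => (s - t)⁻¹ • (c s - c t)) (𝓝[≠] t) (𝓝 c') := by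
  have h1 : HasDerivAt c c' t ↔
      Tendsto (fun s => (s - t)⁻¹ • (c s - c t - (s - t) • c')) (𝓝 t) (𝓝 0) := by
    rw [hasDerivAt_iff_hasFDerivAt, hasFDerivAt_iff_isLittleOTVS,
      Asymptotics.isLittleOTVS_iff_tendsto_inv_smul]
    · simp
    · filter_upwards with s hs
      have : s = t := sub_eq_zero.1 hs
      simp [this]
  have h2 : Tendsto (fun s => (s - t)⁻¹ • (c s - c t - (s - t) • c')) (𝓝 t) (𝓝 0) ↔
      Tendsto (fun s => (s - t)⁻¹ • (c s - c t - (s - t) • c')) (𝓝[≠] t) (𝓝 0) := by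
    refine (tendsto_inf_principal_nhds_iff_of_forall_eq ?_).symm
    intro s hs
    have : s = t := by simpa using hs
    simp [this]
  rw [h1, h2]
  have h3 : ∀ᶠ s in 𝓝[≠] t, (s - t)⁻¹ • (c s - c t - (s - t) • c') =
      (s - t)⁻¹ • (c s - c t) - c' := by
    filter_upwards [self_mem_nhdsWithin] with s hs
    rw [smul_sub, inv_smul_smul₀ (sub_ne_zero.2 hs)]
  rw [tendsto_congr' h3]
  constructor
  · intro h
    simpa using h.add_const c'
  · intro h
    simpa using h.sub_const c'

theorem continuousAt_tvs {c : ℝ → E} {c' : E} {t : ℝ} (hc : HasDerivAt c c' t) :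
    ContinuousAt c t := by
  rw [hasDerivAt_iff_tendsto_inv_smul_sub] at hc
  rw [continuousAt_iff_punctured_nhds]
  have h1 : Tendsto (fun s : ℝ => s - t) (𝓝[≠] t) (𝓝 0) := by
    have : Continuous fun s : ℝ => s - t := by fun_prop
    simpa using (this.tendsto t).mono_left nhdsWithin_le_nhds
  have h2 := (h1.smul hc).const_add (c t)
  rw [zero_smul, add_zero] at h2
  refine h2.congr' ?_
  filter_upwards [self_mem_nhdsWithin] with s hs
  rw [smul_inv_smul₀ (sub_ne_zero.2 hs)]
  abel

theorem hasDerivAt_add_tvs {c d : ℝ → E} {c' d' : E} {t : ℝ} (hc : HasDerivAt c c' t)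
    (hd : HasDerivAt d d' t) : HasDerivAt (fun s => c s + d s) (c' + d') t := by
  rw [hasDerivAt_iff_tendsto_inv_smul_sub] at *
  refine (hc.add hd).congr fun s => ?_
  rw [← smul_add]
  congr 1
  abel

theorem hasDerivAt_smul_tvs {a : ℝ → ℝ} {a' : ℝ} {c : ℝ → E} {c' : E} {t : ℝ}
    (ha : HasDerivAt a a' t) (hc : HasDerivAt c c' t) :
    HasDerivAt (fun s => a s • c s) (a' • c t + a t • c') t := by
  have hca : Tendsto a (𝓝[≠] t) (𝓝 (a t)) := ha.continuousAt.tendsto.mono_left nhdsWithin_le_nhds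
  rw [hasDerivAt_iff_tendsto_inv_smul_sub] at *
  refine ((ha.smul_const (c t)).add (hca.smul hc)).congr fun s => ?_
  rw [smul_comm (a s), smul_eq_mul, mul_smul, ← smul_add, sub_smul, smul_sub]
  congr 1
  abel

/-- The usual factorization proof: `c r - c (γ t)` is `r - γ t` times a function of `r` that is
continuous at `γ t`. -/
theorem hasDerivAt_comp_tvs {γ : ℝ → ℝ} {γ' : ℝ} {c : ℝ → E} {c' : E} {t : ℝ}
    (hc : HasDerivAt c c' (γ t)) (hγ : HasDerivAt γ γ' t) :
    HasDerivAt (fun s => c (γ s)) (γ' • c') t := by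
  have hγc : Tendsto γ (𝓝[≠] t) (𝓝 (γ t)) := hγ.continuousAt.tendsto.mono_left nhdsWithin_le_nhds
  rw [hasDerivAt_iff_tendsto_inv_smul_sub] at *
  -- The difference quotient is completed by its limit at `γ t`, so that times `s` with `γ s = γ t`
  -- need no separate treatment.
  let φ : ℝ → E := Function.update (fun r => (r - γ t)⁻¹ • (c r - c (γ t))) (γ t) c'
  have hφ : ContinuousAt φ (γ t) := continuousAt_update_same.2 hc
  have hφt : φ (γ t) = c' := Function.update_self ..
  have hφ' : ∀ r, c r - c (γ t) = (r - γ t) • φ r := by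
    intro r
    rcases eq_or_ne r (γ t) with rfl | hr
    · simp
    · simp only [φ, Function.update_of_ne hr]
      rw [smul_inv_smul₀ (sub_ne_zero.2 hr)]
  have := hγ.smul (hφ.tendsto.comp hγc)
  rw [hφt] at this
  refine this.congr fun s => ?_
  rw [hφ', smul_assoc, Function.comp_apply]

theorem hasDerivAt_clm_comp_tvs {F : Type*} [NormedAddCommGroup F] [NormedSpace ℝ F]
    (S : F →L[ℝ] E) {γ : ℝ → F} {γ' : F} {t : ℝ} (hγ : HasDerivAt γ γ' t) :
    HasDerivAt (fun s => S (γ s)) (S γ') t := by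
  rw [hasDerivAt_iff_tendsto_inv_smul_sub] at *
  simpa [Function.comp_def] using (S.continuous.tendsto γ').comp hγ

/-- Coinductive principle for smooth curves. -/
theorem IsSmoothCurve.of_mem {M : Set (ℝ → E)}
    (hM : ∀ c ∈ M, ∃ c' ∈ M, ∀ t, HasDerivAt c (c' t) t) {c : ℝ → E} (hc : c ∈ M) :
    IsSmoothCurve c := by
  choose! D hD hD' using hM
  have hmem : ∀ n, D^[n] c ∈ M := by
    intro n
    induction n with
    | zero => exact hc
    | succ n ih => rw [Function.iterate_succ_apply']; exact hD _ ih
  refine ⟨fun n => D^[n] c, rfl, fun n t => ?_⟩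
  simpa only [Function.iterate_succ_apply'] using hD' _ (hmem n) t

theorem IsSmoothCurve.exists_deriv {c : ℝ → E} (hc : IsSmoothCurve c) :
    ∃ c', IsSmoothCurve c' ∧ ∀ t, HasDerivAt c (c' t) t := by
  obtain ⟨d, rfl, hd⟩ := hc
  exact ⟨d 1, ⟨fun n => d (n + 1), rfl, fun n => hd (n + 1)⟩, hd 0⟩

theorem IsSmoothCurve.continuous {c : ℝ → E} (hc : IsSmoothCurve c) : Continuous c := by
  obtain ⟨c', -, h⟩ := hc.exists_deriv
  rw [continuous_iff_continuousAt]
  exact fun t => continuousAt_tvs (h t)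

theorem IsSmoothCurve.add {c d : ℝ → E} (hc : IsSmoothCurve c) (hd : IsSmoothCurve d) :
    IsSmoothCurve fun t => c t + d t := by
  refine IsSmoothCurve.of_mem (M := {f | ∃ c d : ℝ → E, IsSmoothCurve c ∧ IsSmoothCurve d ∧
    f = fun t => c t + d t}) ?_ ⟨c, d, hc, hd, rfl⟩
  rintro _ ⟨c, d, hc, hd, rfl⟩
  obtain ⟨c', hc', h1⟩ := hc.exists_deriv
  obtain ⟨d', hd', h2⟩ := hd.exists_deriv
  exact ⟨_, ⟨c', d', hc', hd', rfl⟩, fun t => hasDerivAt_add_tvs (h1 t) (h2 t)⟩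

/-- Products of smooth scalar functions with smoothly reparametrized smooth curves are smooth. -/
theorem IsSmoothCurve.smul_comp {a γ : ℝ → ℝ} {c : ℝ → E} (ha : ContDiff ℝ ∞ a)
    (hγ : ContDiff ℝ ∞ γ) (hc : IsSmoothCurve c) : IsSmoothCurve fun t => a t • c (γ t) := by
  -- The product rule yields sums of such terms, so the class closed under differentiation is the
  -- additive closure of `M`.
  let M : Set (ℝ → E) := {f | ∃ (a : ℝ → ℝ) (c : ℝ → E), ContDiff ℝ ∞ a ∧ IsSmoothCurve c ∧
    f = fun t => a t • c (γ t)}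
  refine IsSmoothCurve.of_mem (M := (AddSubmonoid.closure M : Set (ℝ → E))) ?_
    (AddSubmonoid.subset_closure ⟨a, c, ha, hc, rfl⟩)
  intro f hf
  induction hf using AddSubmonoid.closure_induction with
  | mem f hf =>
    obtain ⟨a, c, ha, hc, rfl⟩ := hf
    obtain ⟨c', hc', h⟩ := hc.exists_deriv
    have hda := contDiff_infty_iff_deriv.1 ha
    have hdγ := contDiff_infty_iff_deriv.1 hγ
    refine ⟨(fun t => deriv a t • c (γ t)) + fun t => (a t * deriv γ t) • c' (γ t),
      add_mem (AddSubmonoid.subset_closure ⟨_, c, hda.2, hc, rfl⟩)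
        (AddSubmonoid.subset_closure ⟨_, c', ha.mul hdγ.2, hc', rfl⟩), fun t => ?_⟩
    have := hasDerivAt_smul_tvs (hda.1 t).hasDerivAt
      (hasDerivAt_comp_tvs (h (γ t)) (hdγ.1 t).hasDerivAt)
    simpa [mul_smul] using this
  | zero =>
    refine ⟨0, zero_mem _, fun t => ?_⟩
    rw [hasDerivAt_iff_tendsto_inv_smul_sub]
    simpa using tendsto_const_nhds
  | add f g _ _ hf hg =>
    obtain ⟨f', hf', h1⟩ := hf
    obtain ⟨g', hg', h2⟩ := hg
    exact ⟨f' + g', add_mem hf' hg', fun t => hasDerivAt_add_tvs (h1 t) (h2 t)⟩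

theorem IsSmoothCurve.comp {γ : ℝ → ℝ} {c : ℝ → E} (hc : IsSmoothCurve c)
    (hγ : ContDiff ℝ ∞ γ) : IsSmoothCurve fun t => c (γ t) := by
  simpa using IsSmoothCurve.smul_comp (contDiff_const (c := (1 : ℝ))) hγ hc

theorem isSmoothCurve_const (x : E) : IsSmoothCurve fun _ : ℝ => x := by
  refine IsSmoothCurve.of_mem (M := {f | ∃ x : E, f = fun _ => x}) ?_ ⟨x, rfl⟩
  rintro _ ⟨x, rfl⟩
  refine ⟨_, ⟨0, rfl⟩, fun t => ?_⟩
  rw [hasDerivAt_iff_tendsto_inv_smul_sub]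
  simpa using tendsto_const_nhds

theorem isSmoothCurve_smul_const {a : ℝ → ℝ} (ha : ContDiff ℝ ∞ a) (x : E) :
    IsSmoothCurve fun t => a t • x :=
  IsSmoothCurve.smul_comp ha contDiff_id (isSmoothCurve_const x)

theorem IsSmoothCurve.sub_const {c : ℝ → E} (hc : IsSmoothCurve c) (x : E) :
    IsSmoothCurve fun t => c t - x := by
  simpa [sub_eq_add_neg] using hc.add (isSmoothCurve_const (-x))

/-- Continuous linear images of smooth curves in normed spaces are smooth. -/
theorem isSmoothCurve_clm_comp {F : Type*} [NormedAddCommGroup F] [NormedSpace ℝ F]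
    (S : F →L[ℝ] E) {γ : ℝ → F} (hγ : ContDiff ℝ ∞ γ) : IsSmoothCurve fun t => S (γ t) := by
  refine IsSmoothCurve.of_mem (M := {f | ∃ γ : ℝ → F, ContDiff ℝ ∞ γ ∧ f = fun t => S (γ t)}) ?_
    ⟨γ, hγ, rfl⟩
  rintro _ ⟨γ, hγ, rfl⟩
  have h := contDiff_infty_iff_deriv.1 hγ
  exact ⟨_, ⟨_, h.2, rfl⟩, fun t => hasDerivAt_clm_comp_tvs S (h.1 t).hasDerivAt⟩

/-- Real-valued smooth curves in the sense of `IsSmoothCurve` are smooth functions. -/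
theorem IsSmoothCurve.contDiff {c : ℝ → ℝ} (hc : IsSmoothCurve c) : ContDiff ℝ ∞ c := by
  rw [contDiff_infty]
  intro n
  induction n generalizing c with
  | zero => exact contDiff_zero.2 hc.continuous
  | succ n ih =>
    obtain ⟨c', hc', h⟩ := hc.exists_deriv
    have : deriv c = c' := funext fun t => (h t).deriv
    rw [Nat.cast_succ, contDiff_succ_iff_deriv, this]
    refine ⟨fun t => (h t).differentiableAt, by simp, ?_⟩
    exact ih hc'

end Curves

/-- The value of a seminorm at a point is attained by a dominated linear functional. -/
theorem exists_dual_eq_seminorm {E : Type*} [AddCommGroup E] [Module ℝ E] (p : Seminorm ℝ E) (x : E) :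
    ∃ ℓ : E →ₗ[ℝ] ℝ, ℓ x = p x ∧ ∀ y, |ℓ y| ≤ p y := by
  have H : ∀ r : ℝ, r • x = 0 → r • p x = 0 := by
    intro r hr
    rcases smul_eq_zero.1 hr with h | h <;> simp [h]
  let f : E →ₗ.[ℝ] ℝ := LinearPMap.mkSpanSingleton' x (p x) H
  obtain ⟨ℓ, h1, h2⟩ := exists_extension_of_le_sublinear f p
    (fun r hr y => by rw [map_smul_eq_mul, Real.norm_of_nonneg hr.le]) (map_add_le_add p) (by
      rintro ⟨y, hy⟩
      obtain ⟨r, rfl⟩ := Submodule.mem_span_singleton.1 hy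
      have : f ⟨r • x, hy⟩ = r • p x := LinearPMap.mkSpanSingleton'_apply x (p x) H r hy
      rw [this, map_smul_eq_mul, smul_eq_mul]
      exact mul_le_mul_of_nonneg_right (le_abs_self r) (apply_nonneg p x))
  refine ⟨ℓ, ?_, fun y => abs_le.2 ⟨?_, h2 y⟩⟩
  · have := h1 ⟨x, Submodule.mem_span_singleton_self x⟩
    rw [this]
    exact LinearPMap.mkSpanSingleton'_apply_self x (p x) H _
  · have := h2 (-y)
    rw [map_neg, map_neg_eq_map] at this
    linarith

/-! ### Seminorm estimates and bounded linear images of smooth curves -/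

section LocallyConvex

variable {E : Type*} [AddCommGroup E] [Module ℝ E] [TopologicalSpace E]
  [IsTopologicalAddGroup E] [ContinuousSMul ℝ E]

theorem isVonNBounded_iff_forall_seminorm [LocallyConvexSpace ℝ E] {B : Set E} :
    Bornology.IsVonNBounded ℝ B ↔
      ∀ p : Seminorm ℝ E, Continuous p → ∃ C, ∀ x ∈ B, p x ≤ C := by
  rw [(PolynormableSpace.withSeminorms ℝ E).isVonNBounded_iff_seminorm_bddAbove]
  simp [bddAbove_def]

theorem tendsto_iff_forall_seminorm [LocallyConvexSpace ℝ E] {ι : Type*} {l : Filter ι}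
    {f : ι → E} {x : E} : Tendsto f l (𝓝 x) ↔
      ∀ p : Seminorm ℝ E, Continuous p → Tendsto (fun i => p (f i - x)) l (𝓝 0) := by
  rw [(PolynormableSpace.withSeminorms ℝ E).tendsto_nhds]
  constructor
  · intro h p hp
    rw [Metric.tendsto_nhds]
    intro ε hε
    filter_upwards [h ⟨p, hp⟩ ε hε] with i hi
    rw [Real.dist_eq, sub_zero, abs_of_nonneg (apply_nonneg p _)]
    exact hi
  · rintro h ⟨p, hp⟩ ε hε
    exact (h p hp).eventually_lt_const hε

/-- Mean value inequality for seminorms. -/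
theorem seminorm_sub_le_of_hasDerivAt {c c' : ℝ → E} (h : ∀ t, HasDerivAt c (c' t) t)
    {p : Seminorm ℝ E} (hp : Continuous p) {s t C : ℝ} (hC : ∀ u ∈ Set.uIcc s t, p (c' u) ≤ C) :
    p (c t - c s) ≤ C * |t - s| := by
  -- A Hahn–Banach functional norming the increment reduces the claim to the real mean value
  -- inequality.
  obtain ⟨ℓ, h1, h2⟩ := exists_dual_eq_seminorm p (c t - c s)
  have hd : ∀ u, HasDerivAt (fun u => ℓ (c u)) (ℓ (c' u)) u := by
    intro u
    have := h u
    rw [hasDerivAt_iff_tendsto_inv_smul_sub] at this ⊢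
    rw [tendsto_iff_norm_sub_tendsto_zero]
    have h3 := (hp.tendsto 0).comp (by simpa using this.sub_const (c' u))
    rw [map_zero] at h3
    refine squeeze_zero (fun _ => norm_nonneg _) (fun s => ?_) h3
    have := h2 ((s - u)⁻¹ • (c s - c u) - c' u)
    simpa using this
  have := Convex.norm_image_sub_le_of_norm_hasDerivWithin_le (s := Set.uIcc s t)
    (fun u _ => (hd u).hasDerivWithinAt) (fun u hu => (h2 (c' u)).trans (hC u hu))
    (convex_uIcc s t) Set.left_mem_uIcc Set.right_mem_uIcc
  rw [← map_sub, h1, Real.norm_of_nonneg (apply_nonneg _ _)] at this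
  simpa using this

/-- Bounded linear maps preserve derivatives of curves with a locally bounded second
derivative. -/
theorem hasDerivAt_boundedLinear_comp [LocallyConvexSpace ℝ E] {F : Type*} [AddCommGroup F]
    [Module ℝ F] [TopologicalSpace F] [IsTopologicalAddGroup F] [ContinuousSMul ℝ F]
    [LocallyConvexSpace ℝ F] (A : BoundedLinear E F)
    {c c' c'' : ℝ → E} (h : ∀ t, HasDerivAt c (c' t) t) (h' : ∀ t, HasDerivAt c' (c'' t) t)
    (hc'' : Continuous c'') (t : ℝ) : HasDerivAt (fun t => A.1 (c t)) (A.1 (c' t)) t := by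
  -- `A` need not be continuous, so limits cannot be passed through it. Instead the second-order
  -- quotients in `B` are bounded, hence so are their images, and the first-order remainder of `A ∘
  -- c` is `s - t` times such an image.
  let B : Set E := {y | ∃ s, s ≠ t ∧ |s - t| ≤ 1 ∧
    y = (s - t)⁻¹ • ((s - t)⁻¹ • (c s - c t) - c' t)}
  have hB : Bornology.IsVonNBounded ℝ B := by
    rw [isVonNBounded_iff_forall_seminorm]
    intro p hp
    obtain ⟨C, hC⟩ := (isCompact_Icc (a := t - 1) (b := t + 1)).bddAbove_image
      (hp.comp hc'').continuousOn
    have hC' : ∀ u ∈ Set.Icc (t - 1) (t + 1), p (c'' u) ≤ C := fun u hu => hC ⟨u, hu, rfl⟩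
    refine ⟨C, ?_⟩
    rintro _ ⟨s, hs, hs1, rfl⟩
    rw [abs_le] at hs1
    have hsub : Set.uIcc t s ⊆ Set.Icc (t - 1) (t + 1) :=
      Set.uIcc_subset_Icc (by simp) (by constructor <;> linarith)
    -- With the affine part removed, the mean value inequality is used twice: for `c'` with bound
    -- `C`, then for this curve with bound `C * |s - t|`.
    have hd : ∀ u, HasDerivAt (fun u => c u + (t - u) • c' t) (c' u + -c' t) u := by
      intro u
      have h1 : HasDerivAt (fun u => t - u) (-1) u := (hasDerivAt_id u).const_sub t
      have := hasDerivAt_add_tvs (h u) (hasDerivAt_smul_tvs h1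
        (hasDerivAt_iff_tendsto_inv_smul_sub.2 (by simpa using tendsto_const_nhds) :
          HasDerivAt (fun _ => c' t) 0 u))
      simpa using this
    have hb : ∀ u ∈ Set.uIcc t s, p (c' u + -c' t) ≤ C * |s - t| := by
      intro u hu
      rw [← sub_eq_add_neg]
      have hC0 : 0 ≤ C := (apply_nonneg p _).trans (hC' t (by simp))
      refine (seminorm_sub_le_of_hasDerivAt h' hp (C := C) fun v hv => hC' v (hsub ?_)).trans ?_
      · exact Set.uIcc_subset_uIcc_left hu hv
      · exact mul_le_mul_of_nonneg_left (Set.abs_sub_left_of_mem_uIcc hu) hC0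
    have key := seminorm_sub_le_of_hasDerivAt hd hp hb
    have hst : 0 < |s - t| := abs_pos.2 (sub_ne_zero.2 hs)
    have e : (s - t)⁻¹ • ((s - t)⁻¹ • (c s - c t) - c' t) =
        ((s - t)⁻¹ * (s - t)⁻¹) • (c s + (t - s) • c' t - (c t + (t - t) • c' t)) := by
      have : c s + (t - s) • c' t - (c t + (t - t) • c' t) = (c s - c t) - (s - t) • c' t := by
        module
      rw [mul_smul, this, smul_sub _ (c s - c t), inv_smul_smul₀ (sub_ne_zero.2 hs)]
    rw [e, map_smul_eq_mul, norm_mul, norm_inv, Real.norm_eq_abs]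
    calc _ ≤ |s - t|⁻¹ * |s - t|⁻¹ * (C * |s - t| * |s - t|) := by gcongr
      _ = C := by field_simp
  have hAB := isVonNBounded_iff_forall_seminorm.1 (A.2 B hB)
  rw [hasDerivAt_iff_tendsto_inv_smul_sub, tendsto_iff_forall_seminorm]
  intro q hq
  obtain ⟨C, hC⟩ := hAB q hq
  have hlim : Tendsto (fun s => |s - t| * C) (𝓝[≠] t) (𝓝 0) := by
    have : Continuous fun s => |s - t| * C := by fun_prop
    simpa using (this.tendsto t).mono_left nhdsWithin_le_nhds
  refine squeeze_zero' (Eventually.of_forall fun _ => apply_nonneg q _) ?_ hlim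
  have h1 : ∀ᶠ s in 𝓝[≠] t, |s - t| ≤ 1 := by
    refine nhdsWithin_le_nhds ?_
    filter_upwards [Metric.closedBall_mem_nhds t one_pos] with s hs
    simpa [Real.dist_eq] using hs
  filter_upwards [h1, self_mem_nhdsWithin] with s hs1 hs
  have := hC _ ⟨_, ⟨s, hs, hs1, rfl⟩, rfl⟩
  have e : (s - t)⁻¹ • (A.1 (c s) - A.1 (c t)) - A.1 (c' t) =
      (s - t) • A.1 ((s - t)⁻¹ • ((s - t)⁻¹ • (c s - c t) - c' t)) := by
    rw [map_smul, smul_inv_smul₀ (sub_ne_zero.2 hs)]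
    simp
  rw [e, map_smul_eq_mul, Real.norm_eq_abs]
  exact mul_le_mul_of_nonneg_left this (abs_nonneg _)

theorem IsSmoothCurve.boundedLinear_comp [LocallyConvexSpace ℝ E] {F : Type*} [AddCommGroup F]
    [Module ℝ F] [TopologicalSpace F] [IsTopologicalAddGroup F] [ContinuousSMul ℝ F]
    [LocallyConvexSpace ℝ F] (A : BoundedLinear E F) {c : ℝ → E} (hc : IsSmoothCurve c) :
    IsSmoothCurve fun t => A.1 (c t) := by
  refine IsSmoothCurve.of_mem (M := {f | ∃ c : ℝ → E, IsSmoothCurve c ∧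
    f = fun t => A.1 (c t)}) ?_ ⟨c, hc, rfl⟩
  rintro _ ⟨c, hc, rfl⟩
  obtain ⟨c', hc', h⟩ := hc.exists_deriv
  obtain ⟨c'', hc'', h'⟩ := hc'.exists_deriv
  exact ⟨_, ⟨c', hc', rfl⟩, hasDerivAt_boundedLinear_comp A h h' hc''.continuous⟩

theorem IsSmoothCurve.isVonNBounded_image {c : ℝ → E} (hc : IsSmoothCurve c) {K : Set ℝ}
    (hK : IsCompact K) : Bornology.IsVonNBounded ℝ (c '' K) :=
  (hK.image hc.continuous).isVonNBounded ℝ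

end LocallyConvex

/-! ### Smooth curves through fast converging sequences in Banach spaces -/

section SpecialCurves

/-- A bump function centred at `2⁻ⁿ`; the supports for different `n` are disjoint. -/
noncomputable def curveBump (n : ℕ) : ContDiffBump ((1 / 2 : ℝ) ^ n) where
  rIn := (1 / 2) ^ n / 8
  rOut := (1 / 2) ^ n / 4
  rIn_pos := by positivity
  rIn_lt_rOut := by
    have : (0 : ℝ) < (1 / 2) ^ n := by positivity
    linarith

theorem curveBump_eq_zero {m n : ℕ} (h : m ≠ n) {u : ℝ} (hu : |u| ≤ (1 / 2) ^ n / 8) :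
    curveBump m ((1 / 2) ^ n + u) = 0 := by
  refine (curveBump m).zero_of_le_dist ?_
  rw [Real.dist_eq]
  rw [abs_le] at hu
  change (1 / 2 : ℝ) ^ m / 4 ≤ _
  have hm : (0 : ℝ) < (1 / 2) ^ m := by positivity
  have hn : (0 : ℝ) < (1 / 2) ^ n := by positivity
  rcases lt_or_gt_of_ne h with h | h
  · have : (1 / 2 : ℝ) ^ n ≤ (1 / 2) ^ (m + 1) :=
      pow_le_pow_of_le_one (by norm_num) (by norm_num) h
    rw [pow_succ] at this
    rw [abs_sub_comm]
    refine le_trans ?_ (le_abs_self _)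
    linarith
  · have : (1 / 2 : ℝ) ^ m ≤ (1 / 2) ^ (n + 1) :=
      pow_le_pow_of_le_one (by norm_num) (by norm_num) h
    rw [pow_succ] at this
    refine le_trans ?_ (le_abs_self _)
    linarith

theorem curveBump_eq_one (n : ℕ) {u : ℝ} (hu : |u| ≤ (1 / 2) ^ n / 8) :
    curveBump n ((1 / 2) ^ n + u) = 1 := by
  refine (curveBump n).one_of_mem_closedBall ?_
  simpa [Real.dist_eq, curveBump] using hu

theorem curveBump_zero (n : ℕ) : curveBump n 0 = 0 := by
  refine (curveBump n).zero_of_le_dist ?_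
  have hn : (0 : ℝ) < (1 / 2) ^ n := by positivity
  rw [Real.dist_eq, zero_sub, abs_neg, abs_of_pos hn]
  change (1 / 2 : ℝ) ^ n / 4 ≤ _
  linarith

/-- The two components carry position and affine displacement. Keeping them in `ℝ × ℝ` makes the
derivative bounds independent of the target space and of the sequences inserted later. -/
noncomputable def curvePair (n : ℕ) (u : ℝ) : ℝ × ℝ :=
  curveBump n u • ((1 : ℝ), u - (1 / 2) ^ n)

theorem contDiff_curvePair (n : ℕ) : ContDiff ℝ ∞ (curvePair n) := by
  have h1 : ContDiff ℝ ∞ (curveBump n) := (curveBump n).contDiff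
  have h2 : ContDiff ℝ ∞ fun u : ℝ => ((1 : ℝ), u - (1 / 2) ^ n) := by fun_prop
  exact h1.smul h2

theorem hasCompactSupport_curvePair (n : ℕ) : HasCompactSupport (curvePair n) :=
  (curveBump n).hasCompactSupport.smul_right

/-- Only orders `k ≤ n` are controlled by the constant for index `n`. This suffices, because for
each fixed order all but finitely many `n` are covered. -/
theorem exists_curvePair_bound (n : ℕ) :
    ∃ C : ℝ, 0 < C ∧ ∀ k ≤ n, ∀ u, ‖iteratedFDeriv ℝ k (curvePair n) u‖ ≤ C := by
  have h : ∀ k, ∃ C, ∀ u, ‖iteratedFDeriv ℝ k (curvePair n) u‖ ≤ C := fun k =>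
    ((hasCompactSupport_curvePair n).iteratedFDeriv k).exists_bound_of_continuous
      ((contDiff_curvePair n).continuous_iteratedFDeriv (mod_cast le_top))
  choose C hC using h
  have h0 : ∀ k, 0 ≤ C k := fun k => (norm_nonneg _).trans (hC k 0)
  refine ⟨1 + ∑ k ∈ Finset.range (n + 1), C k, ?_, fun k hk u => (hC k u).trans ?_⟩
  · have := Finset.sum_nonneg fun k (_ : k ∈ Finset.range (n + 1)) => h0 k
    linarith
  · have := Finset.single_le_sum (fun k _ => h0 k) (Finset.mem_range.2 (Nat.lt_succ_of_le hk))
    linarith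

/-- Speed of convergence that allows for a smooth curve through a sequence. -/
noncomputable def curveScale (n : ℕ) : ℝ := (1 / 2) ^ n / (exists_curvePair_bound n).choose

theorem curveScale_pos (n : ℕ) : 0 < curveScale n :=
  div_pos (by positivity) (exists_curvePair_bound n).choose_spec.1

/-- The special curve lemma: there is a smooth curve passing through any sufficiently fast
converging sequence at the times `2⁻ⁿ`, with prescribed small velocities, and affine near these
times. -/
theorem exists_contDiff_curve {F : Type*} [NormedAddCommGroup F] [NormedSpace ℝ F]
    [CompleteSpace F] (y w : ℕ → F) (hy : ∀ n, ‖y n‖ ≤ 1) (hw : ∀ n, ‖w n‖ ≤ 1) :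
    ∃ γ : ℝ → F, ContDiff ℝ ∞ γ ∧ γ 0 = 0 ∧
      ∀ n, ∀ᶠ u in 𝓝 (0 : ℝ), γ ((1 / 2) ^ n + u) = curveScale n • (y n + u • w n) := by
  let L : ℕ → ℝ × ℝ →L[ℝ] F := fun n =>
    curveScale n • ((ContinuousLinearMap.fst ℝ ℝ ℝ).smulRight (y n) +
      (ContinuousLinearMap.snd ℝ ℝ ℝ).smulRight (w n))
  have hL : ∀ n, ‖L n‖ ≤ 2 * curveScale n := by
    intro n
    refine ContinuousLinearMap.opNorm_le_bound _ (by have := curveScale_pos n; positivity) ?_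
    rintro ⟨a, b⟩
    have h1 : ‖a • y n + b • w n‖ ≤ 2 * ‖(a, b)‖ := by
      refine (norm_add_le _ _).trans ?_
      rw [norm_smul, norm_smul, two_mul]
      refine add_le_add ?_ ?_
      · refine (mul_le_of_le_one_right (norm_nonneg _) (hy n)).trans (norm_fst_le (a, b))
      · refine (mul_le_of_le_one_right (norm_nonneg _) (hw n)).trans (norm_snd_le (a, b))
    change ‖curveScale n • (a • y n + b • w n)‖ ≤ _
    rw [norm_smul, Real.norm_of_nonneg (curveScale_pos n).le]
    calc _ ≤ curveScale n * (2 * ‖(a, b)‖) := by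
          have := curveScale_pos n; gcongr
      _ = _ := by ring
  let f : ℕ → ℝ → F := fun n u => L n (curvePair n u)
  have hf : ∀ n, ContDiff ℝ ∞ (f n) := fun n => (L n).contDiff.comp (contDiff_curvePair n)
  refine ⟨fun u => ∑' n, f n u, ?_, ?_, ?_⟩
  -- `curveScale n` divides by the bound on the derivatives of `curvePair n`, so the `k`-th
  -- derivatives are dominated by a geometric series from `n = k` on.
  · refine contDiff_tsum_of_eventually (v := fun _ n => 2 * (1 / 2 : ℝ) ^ n) hf
      (fun k _ => summable_geometric_two.mul_left 2) fun k _ => ?_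
    rw [Nat.cofinite_eq_atTop]
    filter_upwards [eventually_ge_atTop k] with n hn u
    obtain ⟨hC0, hC⟩ := (exists_curvePair_bound n).choose_spec
    refine ((L n).norm_iteratedFDeriv_comp_left (contDiff_curvePair n).contDiffAt
      (mod_cast le_top)).trans ?_
    calc _ ≤ 2 * curveScale n * (exists_curvePair_bound n).choose := by
          refine mul_le_mul (hL n) (hC k hn u) (norm_nonneg _) ?_
          have := curveScale_pos n; positivity
      _ = _ := by
          rw [curveScale, mul_assoc, div_mul_cancel₀ _ hC0.ne']
  · have : ∀ n, f n 0 = 0 := fun n => by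
      simp only [f, curvePair, curveBump_zero, zero_smul, map_zero]
    simp [this]
  · intro n
    have hn : (0 : ℝ) < (1 / 2) ^ n / 8 := by positivity
    filter_upwards [Metric.closedBall_mem_nhds (0 : ℝ) hn] with u hu
    have hu' : |u| ≤ (1 / 2) ^ n / 8 := by simpa using hu
    rw [tsum_eq_single n]
    · simp only [f, L, curvePair, curveBump_eq_one n hu']
      simp
    · intro m hm
      simp only [f, curvePair, curveBump_eq_zero hm hu', zero_smul, map_zero]

theorem tendsto_half_pow : Tendsto (fun n : ℕ => (1 / 2 : ℝ) ^ n) atTop (𝓝 0) :=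
  tendsto_pow_atTop_nhds_zero_of_lt_one (by norm_num) (by norm_num)

variable {F : Type*} [NormedAddCommGroup F] [NormedSpace ℝ F] [CompleteSpace F]

/-- A smooth curve through a fast converging sequence, moving affinely in direction `w`. -/
theorem exists_contDiff_curve_through {x : F} {z : ℕ → F}
    (hz : ∀ n, z n ∈ Metric.ball x (curveScale n)) {w : F} (hw : ‖w‖ ≤ 1) :
    ∃ γ : ℝ → F, ContDiff ℝ ∞ γ ∧ γ 0 = x ∧
      ∀ n, ∀ᶠ u in 𝓝 (0 : ℝ), γ ((1 / 2) ^ n + u) = z n + (curveScale n * u) • w := by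
  have hy : ∀ n, ‖(curveScale n)⁻¹ • (z n - x)‖ ≤ 1 := by
    intro n
    have := hz n
    rw [mem_ball_iff_norm] at this
    rw [norm_smul, norm_inv, Real.norm_of_nonneg (curveScale_pos n).le]
    exact inv_mul_le_one_of_le₀ this.le (curveScale_pos n).le
  obtain ⟨γ, hγ, h0, h⟩ := exists_contDiff_curve _ (fun _ => w) hy (fun _ => hw)
  refine ⟨fun u => x + γ u, contDiff_const.add hγ, by simp [h0], fun n => ?_⟩
  filter_upwards [h n] with u hu
  rw [hu, smul_add, smul_inv_smul₀ (curveScale_pos n).ne', mul_smul]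
  module

/-- If `W` is not a neighbourhood of `x ∈ W`, points outside `W` converge to `x` arbitrarily fast. A
smooth curve through them that reaches `x` at time `0` has a preimage of `W` that is not open. -/
theorem isOpen_of_forall_curve {W : Set F}
    (h : ∀ γ : ℝ → F, ContDiff ℝ ∞ γ → IsOpen (γ ⁻¹' W)) : IsOpen W := by
  rw [Metric.isOpen_iff]
  intro x hx
  by_contra! hcon
  have : ∀ n, ∃ z ∈ Metric.ball x (curveScale n), z ∉ W := fun n =>
    Set.not_subset.1 (hcon _ (curveScale_pos n))
  choose z hz hzW using this
  obtain ⟨γ, hγ, h0, hγz⟩ := exists_contDiff_curve_through hz (w := 0) (by simp)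
  have h1 := (h γ hγ).mem_nhds (x := 0) (by simpa [h0] using hx)
  obtain ⟨n, hn⟩ := (tendsto_half_pow.eventually h1).exists
  have h2 := (hγz n).self_of_nhds
  simp only [add_zero, smul_zero] at h2
  exact hzW n (h2 ▸ hn)

theorem continuous_of_forall_curve {Y : Type*} [TopologicalSpace Y] {g : F → Y}
    (h : ∀ γ : ℝ → F, ContDiff ℝ ∞ γ → Continuous (g ∘ γ)) : Continuous g :=
  ⟨fun _ hs => isOpen_of_forall_curve fun γ hγ => hs.preimage (h γ hγ)⟩

end SpecialCurves

/-! ### Boman's theorem for compactly supported functions on Euclidean spaces -/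

section Boman

open MeasureTheory
open scoped FourierTransform RealInnerProductSpace

variable {F : Type*} [NormedAddCommGroup F] [NormedSpace ℝ F]

/-- The `k`-th derivative at `x` of `g` along the line in direction `v`. -/
noncomputable def lineIterDeriv (g : F → ℝ) (v : F) (k : ℕ) (x : F) : ℝ :=
  iteratedDeriv k (fun t : ℝ => g (x + t • v)) 0

/-- `g` is smooth along all smooth curves. -/
def SmoothAlongCurves (g : F → ℝ) : Prop :=
  ∀ γ : ℝ → F, ContDiff ℝ ∞ γ → ContDiff ℝ ∞ (g ∘ γ)

theorem lineIterDeriv_add_smul (g : F → ℝ) (v : F) (k : ℕ) (x : F) (t : ℝ) :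
    lineIterDeriv g v k (x + t • v) = iteratedDeriv k (fun t : ℝ => g (x + t • v)) t := by
  have := congrFun (iteratedDeriv_comp_const_add k (fun t : ℝ => g (x + t • v)) t) 0
  rw [add_zero] at this
  rw [← this, lineIterDeriv]
  simp only [add_smul, add_assoc]

theorem SmoothAlongCurves.line {g : F → ℝ} (hg : SmoothAlongCurves g) (x v : F) :
    ContDiff ℝ ∞ fun t : ℝ => g (x + t • v) :=
  hg (fun t => x + t • v) (by fun_prop)

theorem SmoothAlongCurves.hasLineDerivAt {g : F → ℝ} (hg : SmoothAlongCurves g) (v : F) (k : ℕ)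
    (x : F) : HasLineDerivAt ℝ (lineIterDeriv g v k) (lineIterDeriv g v (k + 1) x) x v := by
  unfold HasLineDerivAt
  simp only [lineIterDeriv_add_smul]
  have h := (hg.line x v).differentiable_iteratedDeriv k (mod_cast WithTop.coe_lt_top _) 0
  have := h.hasDerivAt
  rwa [← iteratedDeriv_succ] at this

theorem lineIterDeriv_eq_zero {g : F → ℝ} {x : F} (hx : x ∉ tsupport g) (v : F) (k : ℕ) :
    lineIterDeriv g v k x = 0 := by
  have h1 : g =ᶠ[𝓝 x] 0 := notMem_tsupport_iff_eventuallyEq.1 hx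
  have hc : Tendsto (fun t : ℝ => x + t • v) (𝓝 0) (𝓝 x) := by
    have : Continuous fun t : ℝ => x + t • v := by fun_prop
    simpa using this.tendsto 0
  have h2 : (fun t : ℝ => g (x + t • v)) =ᶠ[𝓝 0] fun _ => 0 := hc.eventually h1
  rw [lineIterDeriv, h2.iteratedDeriv_eq]
  simp

theorem SmoothAlongCurves.continuous [CompleteSpace F] {g : F → ℝ} (hg : SmoothAlongCurves g) :
    Continuous g :=
  continuous_of_forall_curve fun γ hγ => (hg γ hγ).continuous

/-- Otherwise there are `z n` converging fast to `x` where the derivative exceeds `n / curveScale n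
^ k`. A smooth curve passing `z n` at time `2⁻ⁿ` with velocity `curveScale n • v` makes the `k`-th
derivative of the composite exceed `n` there, contradicting its continuity at `0`. -/
theorem SmoothAlongCurves.locally_bounded [CompleteSpace F] {g : F → ℝ}
    (hg : SmoothAlongCurves g) {v : F} (hv : ‖v‖ ≤ 1) (k : ℕ) (x : F) :
    ∃ C : ℝ, ∀ᶠ y in 𝓝 x, |lineIterDeriv g v k y| ≤ C := by
  by_contra! hcon
  have : ∀ n : ℕ, ∃ z ∈ Metric.ball x (curveScale n),
      n / curveScale n ^ k < |lineIterDeriv g v k z| := by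
    intro n
    have h := hcon (n / curveScale n ^ k)
    obtain ⟨z, h1, h2⟩ :=
      (h.and_eventually (Metric.ball_mem_nhds x (curveScale_pos n))).exists
    exact ⟨z, h2, h1⟩
  choose z hz hzn using this
  obtain ⟨γ, hγ, h0, h⟩ := exists_contDiff_curve_through hz hv
  have key : ∀ n, iteratedDeriv k (g ∘ γ) ((1 / 2) ^ n) =
      curveScale n ^ k * lineIterDeriv g v k (z n) := by
    intro n
    have e1 := congrFun (iteratedDeriv_comp_const_add k (g ∘ γ) ((1 / 2) ^ n)) 0
    rw [add_zero] at e1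
    have e2 : (fun u => (g ∘ γ) ((1 / 2) ^ n + u)) =ᶠ[𝓝 0]
        fun u => (fun t : ℝ => g (z n + t • v)) (curveScale n * u) := by
      filter_upwards [h n] with u hu
      simp only [Function.comp_apply, hu]
    rw [← e1, e2.iteratedDeriv_eq, iteratedDeriv_comp_const_mul
      ((hg.line (z n) v).of_le (mod_cast le_top))]
    simp [lineIterDeriv]
  have hcont : Continuous (iteratedDeriv k (g ∘ γ)) :=
    (hg γ hγ).continuous_iteratedDeriv k (mod_cast le_top)
  have hlim := (hcont.abs.tendsto 0).comp tendsto_half_pow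
  have hb := hlim.eventually_lt_const (lt_add_one _)
  obtain ⟨N, hN⟩ := exists_nat_gt (|iteratedDeriv k (g ∘ γ) 0| + 1)
  obtain ⟨n, hn, hnN⟩ := (hb.and (eventually_ge_atTop N)).exists
  have hs : 0 < curveScale n ^ k := pow_pos (curveScale_pos n) k
  have h3 := hzn n
  rw [div_lt_iff₀ hs] at h3
  have h4 : (N : ℝ) ≤ n := by exact_mod_cast hnN
  simp only [Function.comp_apply, key, abs_mul, abs_of_pos hs] at hn
  linarith [mul_comm (curveScale n ^ k) |lineIterDeriv g v k (z n)|]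

theorem SmoothAlongCurves.bounded [CompleteSpace F] {g : F → ℝ}
    (hg : SmoothAlongCurves g) (hgc : HasCompactSupport g) {v : F} (hv : ‖v‖ ≤ 1) (k : ℕ) :
    ∃ C : ℝ, ∀ x, |lineIterDeriv g v k x| ≤ C := by
  have : ∃ C : ℝ, ∀ x ∈ tsupport g, |lineIterDeriv g v k x| ≤ C := by
    refine IsCompact.induction_on (p := fun s => ∃ C : ℝ, ∀ x ∈ s, |lineIterDeriv g v k x| ≤ C)
      hgc ⟨0, by simp⟩ ?_ ?_ ?_
    · rintro s t hst ⟨C, hC⟩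
      exact ⟨C, fun x hx => hC x (hst hx)⟩
    · rintro s t ⟨C, hC⟩ ⟨D, hD⟩
      refine ⟨max C D, fun x hx => ?_⟩
      rcases hx with hx | hx
      · exact (hC x hx).trans (le_max_left _ _)
      · exact (hD x hx).trans (le_max_right _ _)
    · intro x _
      obtain ⟨C, hC⟩ := hg.locally_bounded hv k x
      exact ⟨_, nhdsWithin_le_nhds hC, C, fun y hy => hy⟩
  obtain ⟨C, hC⟩ := this
  refine ⟨max C 0, fun x => ?_⟩
  by_cases hx : x ∈ tsupport g
  · exact (hC x hx).trans (le_max_left _ _)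
  · rw [lineIterDeriv_eq_zero hx]
    simp

variable {V : Type*} [NormedAddCommGroup V] [InnerProductSpace ℝ V] [FiniteDimensional ℝ V]
  [MeasurableSpace V] [BorelSpace V]

/-- Continuity of the line derivatives is not yet known, but each is a pointwise limit of difference
quotients of the previous one along a sequence of steps. -/
theorem SmoothAlongCurves.measurable {g : V → ℝ}
    (hg : SmoothAlongCurves g) (v : V) (k : ℕ) : Measurable (lineIterDeriv g v k) := by
  have : CompleteSpace V := FiniteDimensional.complete ℝ V
  induction k with
  | zero =>
    have : lineIterDeriv g v 0 = g := by ext x; simp [lineIterDeriv]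
    rw [this]
    exact hg.continuous.measurable
  | succ k ih =>
    let t : ℕ → ℝ := fun n => 1 / ((n : ℝ) + 1)
    have ht : Tendsto t atTop (𝓝[≠] 0) := by
      refine tendsto_nhdsWithin_iff.2 ⟨tendsto_one_div_add_atTop_nhds_zero_nat, ?_⟩
      exact Eventually.of_forall fun n => by
        simp only [t, Set.mem_compl_iff, Set.mem_singleton_iff]; positivity
    refine measurable_of_tendsto_metrizable (f := fun n x =>
      (t n)⁻¹ • (lineIterDeriv g v k (x + t n • v) - lineIterDeriv g v k x)) (fun n => ?_) ?_
    · have : Measurable fun x : V => x + t n • v := by fun_prop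
      exact ((ih.comp this).sub ih).const_smul (t n)⁻¹
    · rw [tendsto_pi_nhds]
      intro x
      have := (hasLineDerivAt_iff_tendsto_slope_zero.1 (hg.hasLineDerivAt v k x)).comp ht
      simpa [Function.comp_def] using this

theorem SmoothAlongCurves.integrable {g : V → ℝ} (hg : SmoothAlongCurves g)
    (hgc : HasCompactSupport g) {v : V} (hv : ‖v‖ ≤ 1) (k : ℕ) :
    Integrable (lineIterDeriv g v k) := by
  have : CompleteSpace V := FiniteDimensional.complete ℝ V
  obtain ⟨C, hC⟩ := hg.bounded hgc hv k
  have h1 : IntegrableOn (lineIterDeriv g v k) (tsupport g) :=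
    Measure.integrableOn_of_bounded (M := C) hgc.measure_lt_top.ne
      (hg.measurable v k).aestronglyMeasurable (Eventually.of_forall hC)
  refine (integrableOn_iff_integrable_of_support_subset ?_).1 h1
  intro x hx
  by_contra hx'
  exact hx (lineIterDeriv_eq_zero hx' v k)

/-- Integration by parts in the single direction `v`; only line derivatives and integrability are
needed, no Fréchet differentiability of `g`. -/
theorem SmoothAlongCurves.fourier_succ {g : V → ℝ} (hg : SmoothAlongCurves g)
    (hgc : HasCompactSupport g) {v : V} (hv : ‖v‖ ≤ 1) (k : ℕ) (ξ : V) :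
    𝓕 (fun x => (lineIterDeriv g v (k + 1) x : ℂ)) ξ =
      (2 * Real.pi * Complex.I * ⟪v, ξ⟫) * 𝓕 (fun x => (lineIterDeriv g v k x : ℂ)) ξ := by
  let e : V → ℂ := fun x => (𝐞 (-⟪x, ξ⟫) : ℂ)
  have he : ∀ x, HasLineDerivAt ℝ e (-(2 * Real.pi * Complex.I * ⟪v, ξ⟫) * e x) x v := by
    intro x
    have h1 := Real.hasDerivAt_fourierChar (-⟪x, ξ⟫)
    have h2 : HasDerivAt (fun t : ℝ => -⟪x + t • v, ξ⟫) (-⟪v, ξ⟫) 0 := by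
      simp only [inner_add_left, inner_smul_left]
      have := (((hasDerivAt_id (0 : ℝ)).mul_const ⟪v, ξ⟫).const_add ⟪x, ξ⟫).neg
      rw [one_mul] at this
      exact this
    have h3 := HasDerivAt.scomp (0 : ℝ) (by simpa using h1) h2
    unfold HasLineDerivAt
    refine h3.congr_deriv ?_
    simp only [e, Complex.real_smul]
    push_cast
    ring
  have hec : Continuous e := by
    simp only [e]; fun_prop
  have hen : ∀ x, ‖e x‖ ≤ 1 := fun x => (Circle.norm_coe _).le
  have hi : ∀ j, Integrable (fun x => (lineIterDeriv g v j x : ℂ)) := fun j =>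
    (hg.integrable hgc hv j).ofReal
  have hie : ∀ j, Integrable (fun x => (lineIterDeriv g v j x : ℂ) * e x) := fun j =>
    (hi j).mul_bdd hec.aestronglyMeasurable (Eventually.of_forall hen)
  have key := integral_bilinear_hasLineDerivAt_right_eq_neg_left_of_integrable (μ := volume)
    (f := fun x => (lineIterDeriv g v k x : ℂ)) (f' := fun x => (lineIterDeriv g v (k + 1) x : ℂ))
    (g := e) (g' := fun x => -(2 * Real.pi * Complex.I * ⟪v, ξ⟫) * e x) (v := v)
    (B := ContinuousLinearMap.mul ℝ ℂ) (hie (k + 1))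
    (by
      have := (hie k).const_mul (-(2 * Real.pi * Complex.I * ⟪v, ξ⟫))
      refine this.congr (Eventually.of_forall fun x => ?_)
      simp
      ring) (hie k)
    (fun x _ => (hg.hasLineDerivAt v k x).ofReal_comp) (fun x _ => he x)
  rw [Real.fourier_eq, Real.fourier_eq]
  simp only [ContinuousLinearMap.mul_apply'] at key
  have h1 : ∀ j, ∫ x, 𝐞 (-⟪x, ξ⟫) • (lineIterDeriv g v j x : ℂ) =
      ∫ x, (lineIterDeriv g v j x : ℂ) * e x := by
    intro j
    congr 1
    ext x
    rw [Circle.smul_def, smul_eq_mul, mul_comm]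
  rw [h1, h1, ← neg_eq_iff_eq_neg.2 key, ← integral_const_mul, ← integral_neg]
  congr 1
  ext x
  ring

theorem SmoothAlongCurves.fourier_bound {g : V → ℝ} (hg : SmoothAlongCurves g)
    (hgc : HasCompactSupport g) {v : V} (hv : ‖v‖ ≤ 1) (k : ℕ) :
    ∃ C, ∀ ξ : V, |⟪v, ξ⟫| ^ k * ‖𝓕 (fun x => (g x : ℂ)) ξ‖ ≤ C := by
  have h : ∀ ξ : V, 𝓕 (fun x => (lineIterDeriv g v k x : ℂ)) ξ =
      (2 * Real.pi * Complex.I * ⟪v, ξ⟫) ^ k * 𝓕 (fun x => (g x : ℂ)) ξ := by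
    intro ξ
    induction k with
    | zero => simp [lineIterDeriv]
    | succ k ih => rw [hg.fourier_succ hgc hv, ih]; ring
  refine ⟨∫ x, ‖(lineIterDeriv g v k x : ℂ)‖, fun ξ => ?_⟩
  have h1 : ‖𝓕 (fun x => (lineIterDeriv g v k x : ℂ)) ξ‖ ≤ ∫ x, ‖(lineIterDeriv g v k x : ℂ)‖ :=
    VectorFourier.norm_fourierIntegral_le_integral_norm _ _ _ _ _
  refine le_trans ?_ h1
  rw [h, norm_mul]
  gcongr
  rw [norm_pow]
  gcongr
  rw [norm_mul]
  have : ‖(2 * Real.pi * Complex.I : ℂ)‖ = 2 * Real.pi := by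
    simp [abs_of_pos Real.pi_pos]
  rw [this, Complex.norm_real, Real.norm_eq_abs]
  have := Real.pi_gt_three
  exact le_mul_of_one_le_left (abs_nonneg _) (by linarith)

/-- For `ξ ≠ 0` some coordinate in an orthonormal basis has size at least `‖ξ‖ / d`, so the bounds
in the basis directions combine. The term `|C0|` takes care of `ξ = 0`. -/
theorem SmoothAlongCurves.fourier_decay {g : V → ℝ} (hg : SmoothAlongCurves g)
    (hgc : HasCompactSupport g) (k : ℕ) :
    ∃ C, ∀ ξ : V, ‖ξ‖ ^ k * ‖𝓕 (fun x => (g x : ℂ)) ξ‖ ≤ C := by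
  let b := stdOrthonormalBasis ℝ V
  let d := Module.finrank ℝ V
  have hb : ∀ i, ∃ C, ∀ ξ : V, |⟪b i, ξ⟫| ^ k * ‖𝓕 (fun x => (g x : ℂ)) ξ‖ ≤ C := fun i =>
    hg.fourier_bound hgc (b.norm_eq_one i).le k
  choose C hC using hb
  have hC0 : ∀ i, 0 ≤ C i := fun i => le_trans (by positivity) (hC i 0)
  obtain ⟨C0, hC0'⟩ := hg.fourier_bound hgc (v := 0) (by simp) 0
  refine ⟨d ^ k * ∑ i, C i + |C0|, fun ξ => ?_⟩
  rcases eq_or_ne ξ 0 with rfl | hξ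
  · have h0 := hC0' 0
    have h1 : 0 ≤ d ^ k * ∑ i, C i := mul_nonneg (by positivity) (Finset.sum_nonneg fun i _ => hC0 i)
    have h2 : ‖(0 : V)‖ ^ k ≤ 1 := pow_le_one₀ (by simp) (by simp)
    simp only [pow_zero, one_mul] at h0
    calc _ ≤ 1 * ‖𝓕 (fun x => (g x : ℂ)) 0‖ := by gcongr
      _ ≤ _ := by rw [one_mul]; linarith [le_abs_self C0]
  · have hsum : ‖ξ‖ ≤ ∑ i, |⟪b i, ξ⟫| := by
      conv_lhs => rw [← b.sum_repr' ξ]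
      refine (norm_sum_le _ _).trans (Finset.sum_le_sum fun i _ => ?_)
      rw [norm_smul, b.norm_eq_one, mul_one, Real.norm_eq_abs]
    have : ∃ i, ‖ξ‖ ≤ d * |⟪b i, ξ⟫| := by
      by_contra! hcon
      have hd : 0 < d := Module.finrank_pos_iff_exists_ne_zero.2 ⟨ξ, hξ⟩
      have : (∑ i : Fin d, d * |⟪b i, ξ⟫|) < ∑ i : Fin d, ‖ξ‖ :=
        Finset.sum_lt_sum_of_nonempty ⟨⟨0, hd⟩, Finset.mem_univ _⟩ fun i _ => hcon i
      rw [← Finset.mul_sum] at this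
      simp only [Finset.sum_const, Finset.card_univ, Fintype.card_fin, nsmul_eq_mul] at this
      have hd' : (0 : ℝ) < d := by exact_mod_cast hd
      have := lt_of_mul_lt_mul_left this hd'.le
      exact absurd hsum (not_le.2 this)
    obtain ⟨i, hi⟩ := this
    calc ‖ξ‖ ^ k * ‖𝓕 (fun x => (g x : ℂ)) ξ‖
        ≤ (d * |⟪b i, ξ⟫|) ^ k * ‖𝓕 (fun x => (g x : ℂ)) ξ‖ := by gcongr
      _ = d ^ k * (|⟪b i, ξ⟫| ^ k * ‖𝓕 (fun x => (g x : ℂ)) ξ‖) := by ring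
      _ ≤ d ^ k * C i := by gcongr; exact hC i ξ
      _ ≤ d ^ k * ∑ i, C i := by
          gcongr
          exact Finset.single_le_sum (fun j _ => hC0 j) (Finset.mem_univ i)
      _ ≤ _ := by linarith [abs_nonneg C0]

/-- The Fourier transform decays faster than every power, so all its moments are integrable, and
Fourier inversion exhibits `g` as the transform of such a function. -/
theorem SmoothAlongCurves.contDiff_of_hasCompactSupport_inner {g : V → ℝ}
    (hg : SmoothAlongCurves g) (hgc : HasCompactSupport g) : ContDiff ℝ ∞ g := by
  have : CompleteSpace V := FiniteDimensional.complete ℝ V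
  let G : V → ℂ := fun x => (g x : ℂ)
  have hG : Continuous G := Complex.continuous_ofReal.comp hg.continuous
  have hGi : Integrable G := by
    have := hg.integrable hgc (v := 0) (by simp) 0
    exact (this.congr (Eventually.of_forall fun x => by simp [lineIterDeriv])).ofReal
  have hFc : Continuous (𝓕 G) := by
    have := Real.contDiff_fourier (f := G) (N := 0) (fun n hn => by
      have : n = 0 := by simpa using hn
      simpa [this] using hGi.norm)
    exact this.continuous
  have hdecay : ∀ n : ℕ, Integrable (fun ξ : V => ‖ξ‖ ^ n * ‖𝓕 G ξ‖) := by
    intro n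
    -- An exponent above the dimension makes `(1 + ‖ξ‖) ^ (-m)` integrable.
    let m := Module.finrank ℝ V + 1
    obtain ⟨C, hC⟩ := hg.fourier_decay hgc n
    obtain ⟨D, hD⟩ := hg.fourier_decay hgc (n + m)
    have hI : Integrable (fun ξ : V => (1 + ‖ξ‖) ^ (-(m : ℝ))) :=
      integrable_one_add_norm (by simp [m])
    refine (hI.const_mul (2 ^ (m - 1) * (C + D))).mono' (by fun_prop)
      (Eventually.of_forall fun ξ => ?_)
    have h1 : (1 + ‖ξ‖) ^ m ≤ 2 ^ (m - 1) * (1 ^ m + ‖ξ‖ ^ m) :=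
      add_pow_le (by norm_num) (norm_nonneg _) m
    have h2 : 0 < (1 + ‖ξ‖) ^ m := by positivity
    rw [Real.rpow_neg (by positivity), Real.rpow_natCast, Real.norm_of_nonneg (by positivity),
      ← div_eq_mul_inv, le_div_iff₀ h2]
    calc _ ≤ ‖ξ‖ ^ n * ‖𝓕 G ξ‖ * (2 ^ (m - 1) * (1 ^ m + ‖ξ‖ ^ m)) := by gcongr
      _ = 2 ^ (m - 1) * (‖ξ‖ ^ n * ‖𝓕 G ξ‖ + ‖ξ‖ ^ (n + m) * ‖𝓕 G ξ‖) := by ring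
      _ ≤ _ := by
          gcongr
          · exact hC ξ
          · exact hD ξ
  have hFi : Integrable (𝓕 G) := by
    have := hdecay 0
    simp only [pow_zero, one_mul] at this
    exact (integrable_norm_iff hFc.aestronglyMeasurable).1 this
  have hinv := hG.fourierInv_fourier_eq hGi hFi
  have hF : ContDiff ℝ ∞ (𝓕 (𝓕 G)) := Real.contDiff_fourier fun n _ => hdecay n
  have hGs : ContDiff ℝ ∞ G := by
    rw [← hinv]
    have : 𝓕⁻ (𝓕 G) = fun x => 𝓕 (𝓕 G) (-x) := by
      ext x
      exact Real.fourierInv_eq_fourier_neg _ _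
    rw [this]
    exact hF.comp contDiff_neg
  exact Complex.reCLM.contDiff.comp hGs

end Boman

/-! ### Boman's theorem on open subsets of finite-dimensional spaces -/

section BomanLocal

variable {V : Type*} [NormedAddCommGroup V] [NormedSpace ℝ V] [FiniteDimensional ℝ V]

theorem SmoothAlongCurves.contDiff_of_hasCompactSupport {g : V → ℝ}
    (hg : SmoothAlongCurves g) (hgc : HasCompactSupport g) : ContDiff ℝ ∞ g := by
  let e := toEuclidean (E := V)
  have h1 : SmoothAlongCurves (g ∘ e.symm) := fun γ hγ =>
    hg (e.symm ∘ γ) (e.symm.contDiff.comp hγ)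
  have h2 : HasCompactSupport (g ∘ e.symm) := hgc.comp_homeomorph e.symm.toHomeomorph
  have h3 := (h1.contDiff_of_hasCompactSupport_inner h2).comp e.contDiff
  convert h3 using 1
  ext x
  simp

/-- **Boman's theorem**: a function on an open subset of a finite-dimensional space that is smooth
along smooth curves is smooth. -/
theorem contDiffAt_of_forall_curve {h : V → ℝ} {W : Set V} (hW : IsOpen W)
    (hh : ∀ γ : ℝ → V, ContDiff ℝ ∞ γ → ∀ u, γ u ∈ W → ContDiffAt ℝ ∞ (h ∘ γ) u)
    {x : V} (hx : x ∈ W) : ContDiffAt ℝ ∞ h x := by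
  obtain ⟨ε, hε, hεW⟩ := Metric.nhds_basis_closedBall.mem_iff.1 (hW.mem_nhds hx)
  let χ : ContDiffBump x := ⟨ε / 2, ε, half_pos hε, half_lt_self hε⟩
  have hχ : ContDiff ℝ ∞ χ := χ.contDiff
  have hts : tsupport χ ⊆ W := by rw [χ.tsupport_eq]; exact hεW
  -- The cutoff gives a globally defined function: outside `W` the factor `χ` vanishes locally, so
  -- the behaviour of `h` there is irrelevant.
  let g : V → ℝ := fun y => χ y * h y
  have hgc : HasCompactSupport g := χ.hasCompactSupport.mul_right
  have hg : SmoothAlongCurves g := by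
    intro γ hγ
    rw [contDiff_iff_contDiffAt]
    intro u
    by_cases hu : γ u ∈ W
    · exact (hχ.comp hγ).contDiffAt.mul (hh γ hγ u hu)
    · have h1 : χ =ᶠ[𝓝 (γ u)] 0 := notMem_tsupport_iff_eventuallyEq.1 fun h => hu (hts h)
      have h2 : g ∘ γ =ᶠ[𝓝 u] fun _ => 0 := by
        filter_upwards [hγ.continuous.continuousAt.tendsto.eventually h1] with s hs
        simp [g, hs]
      exact contDiffAt_const.congr_of_eventuallyEq h2
  refine (hg.contDiff_of_hasCompactSupport hgc).contDiffAt.congr_of_eventuallyEq ?_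
  filter_upwards [χ.eventuallyEq_one] with y hy
  simp [g, hy]

end BomanLocal

/-- Used to reparametrize a curve so that it stays in a short time interval while its germ at the
given time is unchanged. -/
theorem exists_contDiff_local_id {ε : ℝ} (hε : 0 < ε) :
    ∃ ρ : ℝ → ℝ, ContDiff ℝ ∞ ρ ∧ (∀ᶠ t in 𝓝 0, ρ t = t) ∧ ∀ t, |ρ t| ≤ ε := by
  let χ : ContDiffBump (0 : ℝ) := ⟨ε / 2, ε, half_pos hε, half_lt_self hε⟩
  have hχ : ContDiff ℝ ∞ χ := χ.contDiff
  refine ⟨fun t => χ t * t, hχ.mul contDiff_id, ?_, fun t => ?_⟩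
  · filter_upwards [χ.eventuallyEq_one] with t ht
    simp [ht]
  · by_cases ht : |t| ≤ ε
    · rw [abs_mul, abs_of_nonneg χ.nonneg]
      exact (mul_le_of_le_one_left (abs_nonneg _) χ.le_one).trans ht
    · have : χ t = 0 := χ.zero_of_le_dist (by simpa [χ] using (not_le.1 ht).le)
      simp [this, hε.le]

/-! ### Smooth functions on `c^∞`-open sets composed with finite-dimensional families -/

section SmoothMaps

set_option linter.unusedSectionVars false

variable {E : Type*} [AddCommGroup E] [Module ℝ E] [TopologicalSpace E]
  [IsTopologicalAddGroup E] [ContinuousSMul ℝ E]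

theorem isOpen_cInfty_iff {U : Set E} : IsOpen[cInftyTopology E] U ↔
    ∀ c : ℝ → E, IsSmoothCurve c → IsOpen (c ⁻¹' U) := by
  rw [isOpen_iSup_iff]
  simp [isOpen_coinduced]

/-- A smooth curve can be modified away from a time `u` so that it stays in a given `c^∞`-open
neighbourhood. -/
theorem IsSmoothCurve.exists_reparam {U : Set E} (hU : IsOpen[cInftyTopology E] U) {c : ℝ → E}
    (hc : IsSmoothCurve c) {u : ℝ} (hu : c u ∈ U) :
    ∃ d : ℝ → E, IsSmoothCurve d ∧ (∀ t, d t ∈ U) ∧ ∀ᶠ t in 𝓝 u, d t = c t := by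
  obtain ⟨ε, hε, hεU⟩ := Metric.nhds_basis_closedBall.mem_iff.1
    ((isOpen_cInfty_iff.1 hU c hc).mem_nhds hu)
  obtain ⟨ρ, hρ, hρ1, hρ2⟩ := exists_contDiff_local_id hε
  have hs : ContDiff ℝ ∞ fun t => u + ρ (t - u) :=
    contDiff_const.add (hρ.comp (contDiff_id.sub contDiff_const))
  refine ⟨fun t => c (u + ρ (t - u)), hc.comp hs, fun t => hεU ?_, ?_⟩
  · simpa [Real.dist_eq] using hρ2 (t - u)
  · have : Tendsto (fun t : ℝ => t - u) (𝓝 u) (𝓝 0) := by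
      have : Continuous fun t : ℝ => t - u := by fun_prop
      simpa using this.tendsto u
    filter_upwards [this.eventually hρ1] with t ht
    rw [ht]
    simp

theorem IsSmoothOn.contDiffAt_comp {U : Set E} (hU : IsOpen[cInftyTopology E] U) {f : E → ℝ}
    (hf : IsSmoothOn U f) {c : ℝ → E} (hc : IsSmoothCurve c) {u : ℝ} (hu : c u ∈ U) :
    ContDiffAt ℝ ∞ (f ∘ c) u := by
  obtain ⟨d, hd, hdU, hdc⟩ := hc.exists_reparam hU hu
  refine (hf d hd hdU).contDiffAt.congr_of_eventuallyEq ?_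
  filter_upwards [hdc] with t ht
  simp [ht]

/-- A map from a normed space into `E` sending smooth curves to smooth curves. -/
def CurveSmooth {V : Type*} [NormedAddCommGroup V] [NormedSpace ℝ V] (P : V → E) : Prop :=
  ∀ γ : ℝ → V, ContDiff ℝ ∞ γ → IsSmoothCurve (P ∘ γ)

theorem CurveSmooth.isOpen_preimage {V : Type*} [NormedAddCommGroup V] [NormedSpace ℝ V]
    [CompleteSpace V] {P : V → E} (hP : CurveSmooth P) {U : Set E}
    (hU : IsOpen[cInftyTopology E] U) : IsOpen (P ⁻¹' U) :=
  isOpen_of_forall_curve fun γ hγ => isOpen_cInfty_iff.1 hU _ (hP γ hγ)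

/-- Boman's theorem enters here: smoothness along curves becomes joint smoothness in finitely many
real parameters. -/
theorem CurveSmooth.contDiffAt_comp {V : Type*} [NormedAddCommGroup V] [NormedSpace ℝ V]
    [FiniteDimensional ℝ V] {P : V → E} (hP : CurveSmooth P) {U : Set E}
    (hU : IsOpen[cInftyTopology E] U) {f : E → ℝ} (hf : IsSmoothOn U f) {x : V}
    (hx : P x ∈ U) : ContDiffAt ℝ ∞ (f ∘ P) x := by
  have : CompleteSpace V := FiniteDimensional.complete ℝ V
  exact contDiffAt_of_forall_curve (hP.isOpen_preimage hU)
    (fun γ hγ _ hu => hf.contDiffAt_comp hU (hP γ hγ) hu) hx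

end SmoothMaps

/-! ### Directional derivatives: smooth dependence and linearity -/

section DirectionalDerivatives

variable {E : Type*} [AddCommGroup E] [Module ℝ E] [TopologicalSpace E]
  [IsTopologicalAddGroup E] [ContinuousSMul ℝ E]

/-- The directional derivative of `f` at `x` in direction `v`. -/
noncomputable def dirDeriv (f : E → ℝ) (x v : E) : ℝ :=
  deriv (fun t : ℝ => f (x + t • v)) 0

theorem curveSmooth_add_smul {V : Type*} [NormedAddCommGroup V] [NormedSpace ℝ V] {P Q : V → E}
    (hP : CurveSmooth P) (hQ : CurveSmooth Q) :
    CurveSmooth fun q : V × ℝ => P q.1 + q.2 • Q q.1 := by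
  intro γ hγ
  refine (hP _ hγ.fst).add ?_
  exact IsSmoothCurve.smul_comp hγ.snd contDiff_id (hQ _ hγ.fst)

theorem curveSmooth_const {V : Type*} [NormedAddCommGroup V] [NormedSpace ℝ V] (x : E) :
    CurveSmooth fun _ : V => x :=
  fun _ _ => isSmoothCurve_const x

theorem IsSmoothCurve.curveSmooth {c : ℝ → E} (hc : IsSmoothCurve c) : CurveSmooth c :=
  fun _ hγ => hc.comp hγ

variable {U : Set E} {f : E → ℝ}

/-- The directional derivative is the partial derivative at `t = 0` of `f (P q + t • Q q)`, which is
jointly smooth in `(q, t)`. -/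
theorem IsSmoothOn.contDiffAt_dirDeriv (hf : IsSmoothOn U f) (hU : IsOpen[cInftyTopology E] U)
    {V : Type*} [NormedAddCommGroup V] [NormedSpace ℝ V] [FiniteDimensional ℝ V] {P Q : V → E}
    (hP : CurveSmooth P) (hQ : CurveSmooth Q) {q : V} (hq : P q ∈ U) :
    ContDiffAt ℝ ∞ (fun q => dirDeriv f (P q) (Q q)) q := by
  have : CompleteSpace V := FiniteDimensional.complete ℝ V
  let R : V × ℝ → E := fun q => P q.1 + q.2 • Q q.1
  have hR : CurveSmooth R := curveSmooth_add_smul hP hQ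
  have hR0 : ∀ q, R (q, 0) = P q := fun q => by simp [R]
  have h1 : ∀ q, P q ∈ U → ContDiffAt ℝ ∞ (f ∘ R) (q, 0) := fun q hq =>
    hR.contDiffAt_comp hU hf (by rwa [hR0])
  have h2 : ∀ q, P q ∈ U → dirDeriv f (P q) (Q q) = fderiv ℝ (f ∘ R) (q, 0) (0, 1) := by
    intro q hq
    have h3 := ((h1 q hq).differentiableAt (by simp)).hasFDerivAt
    have h4 : HasDerivAt (fun t : ℝ => (q, t)) ((0 : V), (1 : ℝ)) 0 :=
      (hasDerivAt_const _ _).prodMk (hasDerivAt_id _)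
    exact (h3.comp_hasDerivAt (0 : ℝ) h4).deriv
  have h5 : ContDiffAt ℝ ∞ (fun q : V => fderiv ℝ (f ∘ R) (q, 0) (0, 1)) q := by
    have h6 : ContDiffAt ℝ ∞ (fderiv ℝ (f ∘ R)) (q, 0) := (h1 q hq).fderiv_right (by simp)
    have h7 : ContDiffAt ℝ ∞ (fun q : V => (q, (0 : ℝ))) q := by fun_prop
    exact (h6.comp q h7).clm_apply contDiffAt_const
  refine h5.congr_of_eventuallyEq ?_
  filter_upwards [(hP.isOpen_preimage hU).mem_nhds hq] with q hq
  exact h2 q hq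

theorem IsSmoothOn.hasDerivAt_dirDeriv (hf : IsSmoothOn U f) (hU : IsOpen[cInftyTopology E] U)
    {x : E} (hx : x ∈ U) (v : E) :
    HasDerivAt (fun t : ℝ => f (x + t • v)) (dirDeriv f x v) 0 := by
  have hc : IsSmoothCurve fun t : ℝ => x + t • v :=
    (isSmoothCurve_const x).add (isSmoothCurve_smul_const contDiff_id v)
  have := hf.contDiffAt_comp hU hc (u := 0) (by simpa using hx)
  exact (this.differentiableAt (by simp)).hasDerivAt

/-- All directions in the span of `v` and `w` are seen by one two-parameter family, whose Fréchet
derivative is linear. -/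
theorem IsSmoothOn.dirDeriv_linear (hf : IsSmoothOn U f) (hU : IsOpen[cInftyTopology E] U)
    {x : E} (hx : x ∈ U) (v w : E) (s r : ℝ) :
    dirDeriv f x (s • v + r • w) = s * dirDeriv f x v + r * dirDeriv f x w := by
  let P : ℝ × ℝ → E := fun q => x + (q.1 • v + q.2 • w)
  have hP : CurveSmooth P := fun γ hγ => (isSmoothCurve_const x).add
    ((isSmoothCurve_smul_const hγ.fst v).add (isSmoothCurve_smul_const hγ.snd w))
  have h1 : ContDiffAt ℝ ∞ (f ∘ P) (0, 0) := hP.contDiffAt_comp hU hf (by simpa [P] using hx)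
  have h2 := (h1.differentiableAt (by simp)).hasFDerivAt
  have h3 : ∀ a b : ℝ, dirDeriv f x (a • v + b • w) = fderiv ℝ (f ∘ P) (0, 0) (a, b) := by
    intro a b
    have h4 : HasDerivAt (fun t : ℝ => (t * a, t * b)) (a, b) 0 := by
      simpa using ((hasDerivAt_id (0 : ℝ)).mul_const a).prodMk ((hasDerivAt_id (0 : ℝ)).mul_const b)
    have h5 := (HasFDerivAt.comp_hasDerivAt (0 : ℝ) (by simpa using h2) h4).deriv
    rw [← h5, dirDeriv]
    congr 1
    ext t
    simp [P, mul_smul, smul_add]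
  have e1 := h3 1 0
  have e2 := h3 0 1
  simp only [one_smul, zero_smul, add_zero, zero_add] at e1 e2
  rw [h3, e1, e2, ← smul_eq_mul, ← smul_eq_mul, ← map_smul, ← map_smul, ← map_add]
  simp

/-- The directional derivative as a linear map in the direction. -/
noncomputable def IsSmoothOn.dirDerivLM (hf : IsSmoothOn U f) (hU : IsOpen[cInftyTopology E] U)
    {x : E} (hx : x ∈ U) : E →ₗ[ℝ] ℝ where
  toFun := dirDeriv f x
  map_add' v w := by simpa using hf.dirDeriv_linear hU hx v w 1 1
  map_smul' s v := by simpa using hf.dirDeriv_linear hU hx v 0 s 0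

end DirectionalDerivatives

/-! ### Fast converging series in convenient spaces -/

section FastSeries

set_option linter.unusedSectionVars false

variable {E : Type*} [AddCommGroup E] [Module ℝ E] [TopologicalSpace E]
  [IsTopologicalAddGroup E] [ContinuousSMul ℝ E] [LocallyConvexSpace ℝ E]

/-- Bounded sequences of coefficients. -/
abbrev BddSeq : Type := BoundedContinuousFunction ℕ ℝ

theorem norm_single_one_le (n m : ℕ) : ‖(Pi.single n 1 : ℕ → ℝ) m‖ ≤ 1 := by
  rcases eq_or_ne m n with rfl | h
  · simp
  · simp [Pi.single_eq_of_ne h]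

/-- The `n`-th unit vector in the space of bounded sequences. -/
noncomputable def unitSeq (n : ℕ) : BddSeq :=
  BoundedContinuousFunction.ofNormedAddCommGroupDiscrete (Pi.single n 1) 1 (norm_single_one_le n)

theorem unitSeq_self (n : ℕ) : unitSeq n n = 1 := by
  simp [unitSeq]

theorem unitSeq_of_ne {m n : ℕ} (h : m ≠ n) : unitSeq n m = 0 := by
  simp [unitSeq, Pi.single_eq_of_ne h]

theorem norm_unitSeq_le (n : ℕ) : ‖unitSeq n‖ ≤ 1 :=
  (BoundedContinuousFunction.norm_le zero_le_one).2 (norm_single_one_le n)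

/-- Partial sums of the series `∑ 2⁻ⁿ bₙ vₙ`. -/
noncomputable def partialSum (v : ℕ → E) (b : BddSeq) (N : ℕ) : E :=
  ∑ n ∈ Finset.range N, ((1 / 2 : ℝ) ^ n * b n) • v n

theorem seminorm_partialSum_sub_le {v : ℕ → E} {p : Seminorm ℝ E} {C : ℝ} (hC : ∀ n, p (v n) ≤ C)
    (b : BddSeq) {N M : ℕ} (h : N ≤ M) :
    p (partialSum v b M - partialSum v b N) ≤ 2 * C * ‖b‖ * ((1 / 2) ^ N - (1 / 2) ^ M) := by
  induction M, h using Nat.le_induction with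
  | base => simp
  | succ M h ih =>
    have e : partialSum v b (M + 1) - partialSum v b N =
        (partialSum v b M - partialSum v b N) + ((1 / 2 : ℝ) ^ M * b M) • v M := by
      rw [partialSum, Finset.sum_range_succ, ← partialSum]
      abel
    rw [e]
    refine (map_add_le_add p _ _).trans ?_
    have h1 : p (((1 / 2 : ℝ) ^ M * b M) • v M) ≤ (1 / 2 : ℝ) ^ M * ‖b‖ * C := by
      rw [map_smul_eq_mul, norm_mul, norm_pow]
      have := b.norm_coe_le_norm M
      have h2 := hC M
      have h3 : ‖(1 / 2 : ℝ)‖ = 1 / 2 := by norm_num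
      rw [h3]
      gcongr
    refine (add_le_add ih h1).trans (le_of_eq ?_)
    rw [pow_succ]
    ring

theorem exists_tendsto_partialSum (hE : IsConvenient E) {v : ℕ → E}
    (hv : Bornology.IsVonNBounded ℝ (Set.range v)) (b : BddSeq) :
    ∃ x, Tendsto (partialSum v b) atTop (𝓝 x) := by
  -- The tail after `N` is of size `2⁻ᴺ` in every continuous seminorm, so `2 ^ min N M` is an
  -- admissible Mackey rate.
  refine hE _ ⟨fun p => 2 ^ min p.1 p.2, fun p => by positivity, ?_, ?_⟩
  · refine (tendsto_pow_atTop_atTop_of_one_lt one_lt_two).comp ?_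
    rw [tendsto_atTop]
    intro n
    filter_upwards [eventually_ge_atTop (n, n)] with p hp
    exact le_min hp.1 hp.2
  · rw [isVonNBounded_iff_forall_seminorm] at hv ⊢
    intro p hp
    obtain ⟨C, hC⟩ := hv p hp
    have hC' : ∀ n, p (v n) ≤ C := fun n => hC _ ⟨n, rfl⟩
    have hC0 : 0 ≤ C := (apply_nonneg p _).trans (hC' 0)
    have key : ∀ N M, N ≤ M →
        2 ^ N * p (partialSum v b M - partialSum v b N) ≤ 2 * C * ‖b‖ := by
      intro N M h
      have h1 := seminorm_partialSum_sub_le hC' b h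
      have h2 : (0 : ℝ) ≤ (1 / 2) ^ M := by positivity
      have h3 : p (partialSum v b M - partialSum v b N) ≤ 2 * C * ‖b‖ * (1 / 2) ^ N :=
        h1.trans (by gcongr; linarith)
      calc _ ≤ 2 ^ N * (2 * C * ‖b‖ * (1 / 2) ^ N) := by gcongr
        _ = 2 * C * ‖b‖ * (2 * (1 / 2)) ^ N := by rw [mul_pow]; ring
        _ = _ := by norm_num
    refine ⟨2 * C * ‖b‖, ?_⟩
    rintro _ ⟨⟨N, M⟩, rfl⟩
    simp only [map_smul_eq_mul, norm_pow, Real.norm_ofNat]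
    rcases le_total N M with h | h
    · rw [min_eq_left h, map_sub_rev]
      exact key N M h
    · rw [min_eq_right h]
      exact key M N h

variable [T2Space E]

/-- In a convenient vector space the series `∑ 2⁻ⁿ bₙ vₙ` converges for bounded sequences `v` and
depends continuously on the bounded sequence of coefficients `b`. -/
theorem exists_sumMap (hE : IsConvenient E) {v : ℕ → E}
    (hv : Bornology.IsVonNBounded ℝ (Set.range v)) :
    ∃ S : BddSeq →L[ℝ] E, (∀ b, Tendsto (partialSum v b) atTop (𝓝 (S b))) ∧
      (∀ n, S (unitSeq n) = (1 / 2 : ℝ) ^ n • v n) ∧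
      ∀ p : Seminorm ℝ E, Continuous p → ∀ C, (∀ n, p (v n) ≤ C) → ∀ b, p (S b) ≤ 2 * C * ‖b‖ := by
  choose S hS using exists_tendsto_partialSum hE hv
  have hadd : ∀ b b', S (b + b') = S b + S b' := fun b b' =>
    tendsto_nhds_unique (hS _) (((hS b).add (hS b')).congr fun N => by
      simp [partialSum, mul_add, add_smul, Finset.sum_add_distrib])
  have hsmul : ∀ (r : ℝ) b, S (r • b) = r • S b := fun r b =>
    tendsto_nhds_unique (hS _) (((hS b).const_smul r).congr fun N => by
      simp only [partialSum, Finset.smul_sum, smul_smul]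
      refine Finset.sum_congr rfl fun n _ => ?_
      congr 1
      simp
      ring)
  let S' : BddSeq →ₗ[ℝ] E := { toFun := S, map_add' := hadd, map_smul' := hsmul }
  have hp : ∀ p : Seminorm ℝ E, Continuous p → ∀ C, (∀ n, p (v n) ≤ C) → ∀ b,
      p (S b) ≤ 2 * C * ‖b‖ := by
    intro p hp C hC b
    refine le_of_tendsto ((hp.tendsto _).comp (hS b)) (Eventually.of_forall fun N => ?_)
    have := seminorm_partialSum_sub_le hC b (Nat.zero_le N)
    have hC0 : 0 ≤ C := (apply_nonneg p _).trans (hC 0)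
    have h2 : (0 : ℝ) ≤ (1 / 2) ^ N := by positivity
    simp only [partialSum, Finset.range_zero, Finset.sum_empty, sub_zero, pow_zero] at this
    refine this.trans ?_
    exact mul_le_of_le_one_right (by positivity) (by linarith)
  have hcont : Continuous S' := by
    refine continuous_of_continuousAt_zero S' ?_
    rw [ContinuousAt, map_zero, tendsto_iff_forall_seminorm]
    intro p hpc
    obtain ⟨C, hC⟩ := isVonNBounded_iff_forall_seminorm.1 hv p hpc
    have hlim : Tendsto (fun b : BddSeq => 2 * C * ‖b‖) (𝓝 0) (𝓝 0) := by
      have : Continuous fun b : BddSeq => 2 * C * ‖b‖ := by fun_prop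
      simpa using this.tendsto 0
    refine squeeze_zero (fun _ => apply_nonneg p _) (fun b => ?_) hlim
    rw [sub_zero]
    exact hp p hpc C (fun n => hC _ ⟨n, rfl⟩) b
  refine ⟨⟨S', hcont⟩, hS, fun n => ?_, hp⟩
  refine tendsto_nhds_unique (hS _) (tendsto_const_nhds.congr' ?_)
  filter_upwards [eventually_gt_atTop n] with N hN
  rw [partialSum, Finset.sum_eq_single n]
  · simp [unitSeq_self]
  · intro m _ hm
    simp [unitSeq_of_ne hm]
  · intro h
    exact absurd (Finset.mem_range.2 hN) h

/-- Summation of bounded sequences of operators. -/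
theorem exists_sumOperator (hE : IsConvenient E) {A : ℕ → BoundedLinear E E}
    (hA : IsBoundedMaps (Set.range A)) :
    ∃ S : BddSeq →ₗ[ℝ] BoundedLinear E E, (∀ n, S (unitSeq n) = (1 / 2 : ℝ) ^ n • A n) ∧
      ∀ x, Continuous fun b => (S b).1 x := by
  have hb : ∀ x, Bornology.IsVonNBounded ℝ (Set.range fun n => (A n).1 x) := by
    intro x
    refine (hA {x} (Bornology.isVonNBounded_singleton x)).subset ?_
    rintro _ ⟨n, rfl⟩
    exact ⟨A n, ⟨n, rfl⟩, x, rfl, rfl⟩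
  choose S hS hS1 hS2 using fun x => exists_sumMap hE (hb x)
  have hadd : ∀ b x x', S (x + x') b = S x b + S x' b := fun b x x' =>
    tendsto_nhds_unique (hS _ b) (((hS x b).add (hS x' b)).congr fun N => by
      simp [partialSum, Finset.sum_add_distrib])
  have hsmul : ∀ b (r : ℝ) x, S (r • x) b = r • S x b := fun b r x =>
    tendsto_nhds_unique (hS _ b) (((hS x b).const_smul r).congr fun N => by
      simp only [partialSum, Finset.smul_sum, map_smul]
      refine Finset.sum_congr rfl fun n _ => ?_
      rw [smul_comm])
  let T : BddSeq → E →ₗ[ℝ] E := fun b =>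
    { toFun := fun x => S x b, map_add' := hadd b, map_smul' := hsmul b }
  have hT : ∀ b, T b ∈ BoundedLinear E E := by
    intro b B hB
    have hAB := hA B hB
    rw [isVonNBounded_iff_forall_seminorm] at hAB ⊢
    intro p hp
    obtain ⟨C, hC⟩ := hAB p hp
    -- The estimate for the sum at `x` depends only on a bound for `p (A n x)`, which is uniform in
    -- `x ∈ B`.
    refine ⟨2 * C * ‖b‖, ?_⟩
    rintro _ ⟨x, hx, rfl⟩
    exact hS2 x p hp C (fun n => hC _ ⟨A n, ⟨n, rfl⟩, x, hx, rfl⟩) b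
  refine ⟨{ toFun := fun b => ⟨T b, hT b⟩, map_add' := ?_, map_smul' := ?_ }, fun n => ?_,
    fun x => (S x).continuous⟩
  · intro b b'
    ext x
    simp [T]
  · intro r b
    ext x
    simp [T]
  · ext x
    simpa [T] using hS1 x n

/-- A smooth curve moving near the times `2⁻ⁿ` along small multiples of a bounded sequence `v`. -/
theorem exists_isSmoothCurve_through (hE : IsConvenient E) {v : ℕ → E}
    (hv : Bornology.IsVonNBounded ℝ (Set.range v)) {y w : ℝ} (hy : |y| ≤ 1) (hw : |w| ≤ 1) :
    ∃ c : ℝ → E, IsSmoothCurve c ∧ c 0 = 0 ∧ ∀ n, ∀ᶠ u in 𝓝 (0 : ℝ), c ((1 / 2) ^ n + u) =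
      (curveScale n * (1 / 2) ^ n * (y + u * w)) • v n := by
  obtain ⟨S, -, hS, -⟩ := exists_sumMap hE hv
  have h1 : ∀ {r : ℝ}, |r| ≤ 1 → ∀ n, ‖r • unitSeq n‖ ≤ 1 := by
    intro r hr n
    rw [norm_smul]
    exact mul_le_one₀ hr (norm_nonneg _) (norm_unitSeq_le n)
  obtain ⟨γ, hγ, h0, h⟩ := exists_contDiff_curve (fun n => y • unitSeq n) (fun n => w • unitSeq n)
    (h1 hy) (h1 hw)
  refine ⟨fun t => S (γ t), isSmoothCurve_clm_comp S hγ, by simp [h0], fun n => ?_⟩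
  filter_upwards [h n] with u hu
  rw [hu]
  simp only [map_smul, map_add, hS]
  module

/-- A linear functional that is continuous along smooth curves is bounded. -/
theorem mem_bdual_of_continuous_comp (hE : IsConvenient E) (ℓ : E →ₗ[ℝ] ℝ)
    (hℓ : ∀ c : ℝ → E, IsSmoothCurve c → Continuous (ℓ ∘ c)) : ℓ ∈ BDual E := by
  intro B hB
  rw [NormedSpace.isVonNBounded_iff, isBounded_iff_forall_norm_le]
  by_contra! hcon
  have : ∀ n : ℕ, ∃ v ∈ B, n / (curveScale n * (1 / 2) ^ n) < |ℓ v| := by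
    intro n
    obtain ⟨_, ⟨v, hv, rfl⟩, h⟩ := hcon (n / (curveScale n * (1 / 2) ^ n))
    exact ⟨v, hv, h⟩
  choose v hv hvn using this
  -- With `y = 1` and `w = 0` the curve visits the scaled `v n` at the times `2⁻ⁿ`; there `|ℓ|`
  -- exceeds `n` although `ℓ (c 0) = 0`.
  obtain ⟨c, hc, h0, h⟩ := exists_isSmoothCurve_through hE
    (hB.subset (Set.range_subset_iff.2 hv)) (y := 1) (w := 0) (by simp) (by simp)
  have hlim := ((hℓ c hc).abs.tendsto 0).comp tendsto_half_pow
  have hb := hlim.eventually_lt_const (lt_add_one _)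
  obtain ⟨n, hn, hn1⟩ := (hb.and (eventually_ge_atTop 1)).exists
  have h1 := (h n).self_of_nhds
  have hs : 0 < curveScale n * (1 / 2) ^ n := mul_pos (curveScale_pos n) (by positivity)
  have h2 := hvn n
  rw [div_lt_iff₀ hs] at h2
  have h3 : (1 : ℝ) ≤ n := by exact_mod_cast hn1
  simp only [add_zero, zero_mul, mul_one] at h1
  simp only [Function.comp_apply, h1, h0, map_zero, abs_zero, zero_add, map_smul, smul_eq_mul,
    abs_mul _ (ℓ _), abs_of_pos hs] at hn
  linarith [mul_comm (curveScale n * (1 / 2) ^ n) |ℓ (v n)|]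

end FastSeries

/-! ### Existence and boundedness of differentials -/

section Differentials

set_option linter.unusedSectionVars false

variable {E : Type*} [AddCommGroup E] [Module ℝ E] [TopologicalSpace E]
  [IsTopologicalAddGroup E] [ContinuousSMul ℝ E] [LocallyConvexSpace ℝ E] [T2Space E]

/-- Only boundedness in the direction is at stake; it follows from continuity of the directional
derivative along smooth curves of directions. -/
theorem IsSmoothOn.exists_isDifferential (hE : IsConvenient E) {U : Set E} {f : E → ℝ}
    (hf : IsSmoothOn U f) (hU : IsOpen[cInftyTopology E] U) {x : E} (hx : x ∈ U) :
    ∃ φ : BDual E, IsDifferential f x φ := by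
  refine ⟨⟨hf.dirDerivLM hU hx, mem_bdual_of_continuous_comp hE _ fun c hc => ?_⟩,
    hf.hasDerivAt_dirDeriv hU hx⟩
  rw [continuous_iff_continuousAt]
  intro t
  exact (hf.contDiffAt_dirDeriv hU (curveSmooth_const x) hc.curveSmooth hx).continuousAt

theorem IsDifferential.apply_eq_dirDeriv {f : E → ℝ} {x : E} {φ : BDual E}
    (h : IsDifferential f x φ) (v : E) : φ.1 v = dirDeriv f x v :=
  (h v).deriv.symm

theorem IsDifferential.unique {f : E → ℝ} {x : E} {φ ψ : BDual E}
    (h : IsDifferential f x φ) (h' : IsDifferential f x ψ) : φ = ψ :=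
  Subtype.ext (LinearMap.ext fun v => (h v).unique (h' v))

/-- The differentials at `a` of a bounded set of smooth functions are bounded. -/
theorem IsBoundedSmooth.exists_dirDeriv_le (hE : IsConvenient E) {a : E} {U : Set E}
    (hU : IsCInftyNhd a U) {𝓕 : Set (E → ℝ)} (h𝓕 : IsBoundedSmooth U 𝓕) {B : Set E}
    (hB : Bornology.IsVonNBounded ℝ B) : ∃ C, ∀ f ∈ 𝓕, ∀ v ∈ B, |dirDeriv f a v| ≤ C := by
  by_contra! hcon
  have : ∀ n : ℕ, ∃ f ∈ 𝓕, ∃ v ∈ B, n / (curveScale n * (1 / 2) ^ n) < |dirDeriv f a v| :=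
    fun n => hcon _
  choose f hf v hv hfv using this
  -- With `y = 0` and `w = 1` the curve is at `0` at each time `2⁻ⁿ`, moving with velocity a small
  -- multiple of `v n`. So first derivatives along one curve record `dirDeriv (f n) a (v n)` for all
  -- large `n`.
  obtain ⟨c, hc, h0, h⟩ := exists_isSmoothCurve_through hE
    (hB.subset (Set.range_subset_iff.2 hv)) (y := 0) (w := 1) (by simp) (by simp)
  have hac : IsSmoothCurve fun t => a + c t := (isSmoothCurve_const a).add hc
  obtain ⟨d, hd, hdU, hdc⟩ := hac.exists_reparam hU.1 (u := 0) (by simpa [h0] using hU.2)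
  obtain ⟨M, hM⟩ := isBounded_iff_forall_norm_le.1
    (h𝓕.2 d hd hdU 1 (Set.Icc 0 1) isCompact_Icc)
  obtain ⟨N, hN⟩ := exists_nat_gt M
  obtain ⟨n, hn, hnN⟩ :=
    ((tendsto_half_pow.eventually hdc.eventually_nhds).and (eventually_ge_atTop N)).exists
  let κ := curveScale n * (1 / 2 : ℝ) ^ n
  have hκ : 0 < κ := mul_pos (curveScale_pos n) (by positivity)
  have hshift : Tendsto (fun u : ℝ => (1 / 2 : ℝ) ^ n + u) (𝓝 0) (𝓝 ((1 / 2) ^ n)) := by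
    have : Continuous fun u : ℝ => (1 / 2 : ℝ) ^ n + u := by fun_prop
    simpa only [add_zero] using this.tendsto 0
  have e : (fun u => (f n ∘ d) ((1 / 2) ^ n + u)) =ᶠ[𝓝 0] fun u => f n (a + (κ * u) • v n) := by
    filter_upwards [h n, hshift.eventually hn] with u hu hu'
    simp only [Function.comp_apply, hu', hu, zero_add, mul_one, κ]
  have hder : deriv (f n ∘ d) ((1 / 2) ^ n) = κ * dirDeriv (f n) a (v n) := by
    have e1 := deriv_comp_const_add (f n ∘ d) ((1 / 2) ^ n) 0
    rw [add_zero] at e1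
    rw [← e1, e.deriv_eq]
    have h1 : HasDerivAt (fun u : ℝ => κ * u) κ 0 := by
      simpa using (hasDerivAt_id (0 : ℝ)).const_mul κ
    have h2 := (h𝓕.1 (f n) (hf n)).hasDerivAt_dirDeriv hU.1 hU.2 (v n)
    have h3 := (HasDerivAt.scomp (0 : ℝ) (by simpa using h2) h1).deriv
    simpa [Function.comp_def] using h3
  have h4 := hM _ ⟨f n, hf n, (1 / 2) ^ n, ⟨by positivity, pow_le_one₀ (by norm_num) (by norm_num)⟩,
    rfl⟩
  rw [iteratedDeriv_one, hder, Real.norm_eq_abs, abs_mul, abs_of_pos hκ] at h4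
  have h5 := hfv n
  rw [div_lt_iff₀ hκ] at h5
  have h6 : (N : ℝ) ≤ n := by exact_mod_cast hnN
  linarith [mul_comm κ |dirDeriv (f n) a (v n)|]

end Differentials

/-! ### Banach–Steinhaus for families of smooth real curves -/

section UniformBoundedness

variable {X : Type*} [NormedAddCommGroup X] [NormedSpace ℝ X] [CompleteSpace X]

/-- By induction, each derivative is a pointwise limit of difference quotients of continuous
functionals, hence itself continuous on the Banach space `X`. -/
theorem exists_clm_eq_iteratedDeriv (T : X →ₗ[ℝ] ℝ → ℝ) (hc : ∀ s, Continuous fun x => T x s)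
    (hs : ∀ x, ContDiff ℝ ∞ (T x)) (k : ℕ) (s : ℝ) :
    ∃ L : X →L[ℝ] ℝ, ∀ x, L x = iteratedDeriv k (T x) s := by
  induction k generalizing s with
  | zero => exact ⟨⟨(LinearMap.proj s).comp T, hc s⟩, fun x => rfl⟩
  | succ k ih =>
    choose L hL using ih
    have h : Tendsto (fun (t : ℝ) x => (t⁻¹ • (L (s + t) - L s)) x) (𝓝[≠] 0)
        (𝓝 fun x => iteratedDeriv (k + 1) (T x) s) := by
      rw [tendsto_pi_nhds]
      intro x
      have hd : HasDerivAt (iteratedDeriv k (T x)) (iteratedDeriv (k + 1) (T x) s) s := by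
        rw [iteratedDeriv_succ]
        exact ((hs x).differentiable_iteratedDeriv k (mod_cast WithTop.coe_lt_top _) s).hasDerivAt
      simpa [hL] using hasDerivAt_iff_tendsto_slope_zero.1 hd
    exact ⟨continuousLinearMapOfTendsto _ h, fun x => rfl⟩

/-- A pointwise continuous linear map from a Banach space to smooth functions is bounded for the
topology of locally uniform convergence of all derivatives. -/
theorem exists_iteratedDeriv_le (T : X →ₗ[ℝ] ℝ → ℝ) (hc : ∀ s, Continuous fun x => T x s)
    (hs : ∀ x, ContDiff ℝ ∞ (T x)) (k : ℕ) {K : Set ℝ} (hK : IsCompact K) :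
    ∃ C, ∀ x, ∀ s ∈ K, |iteratedDeriv k (T x) s| ≤ C * ‖x‖ := by
  choose L hL using exists_clm_eq_iteratedDeriv T hc hs k
  obtain ⟨C, hC⟩ := banach_steinhaus (g := fun s : K => L s) fun x => by
    obtain ⟨C, hC⟩ := hK.exists_bound_of_continuousOn
      ((hs x).continuous_iteratedDeriv k (mod_cast le_top)).continuousOn
    exact ⟨C, fun s => by rw [hL]; exact hC s s.2⟩
  refine ⟨C, fun x s hsK => ?_⟩
  rw [← hL, ← Real.norm_eq_abs]
  exact (L s).le_of_opNorm_le (hC ⟨s, hsK⟩) x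

end UniformBoundedness

/-! ### Smoothness of parametric integrals -/

section ParametricIntegral

theorem hasDerivAt_integral_of_contDiff {H : ℝ × ℝ → ℝ} (hH : ContDiff ℝ ∞ H) (s : ℝ) :
    HasDerivAt (fun s => ∫ u in (0 : ℝ)..1, H (u, s))
      (∫ u in (0 : ℝ)..1, fderiv ℝ H (u, s) (0, 1)) s := by
  have hH' : Continuous fun q : ℝ × ℝ => fderiv ℝ H q (0, 1) :=
    (hH.continuous_fderiv (by simp)).clm_apply continuous_const
  obtain ⟨C, hC⟩ := (isCompact_Icc (a := (0 : ℝ)) (b := 1)).prod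
    (isCompact_closedBall s 1) |>.exists_bound_of_continuousOn hH'.continuousOn
  have hcont : ∀ s, Continuous fun u => H (u, s) := fun s =>
    hH.continuous.comp (by fun_prop)
  refine (intervalIntegral.hasDerivAt_integral_of_dominated_loc_of_deriv_le
    (F := fun s u => H (u, s)) (F' := fun s u => fderiv ℝ H (u, s) (0, 1)) (bound := fun _ => C)
    (Metric.closedBall_mem_nhds s one_pos)
    (Eventually.of_forall fun s => (hcont s).aestronglyMeasurable)
    ((hcont s).intervalIntegrable _ _) ?_ ?_ ?_ ?_).2
  · exact (hH'.comp (by fun_prop : Continuous fun u : ℝ => (u, s))).aestronglyMeasurable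
  · refine Eventually.of_forall fun u hu r hr => hC (u, r) ⟨?_, hr⟩
    rw [Set.uIoc_of_le zero_le_one] at hu
    exact Set.Ioc_subset_Icc_self hu
  · exact intervalIntegrable_const
  · refine Eventually.of_forall fun u _ r _ => ?_
    have h1 := ((hH.differentiable (by simp)) (u, r)).hasFDerivAt
    have h2 : HasDerivAt (fun r : ℝ => (u, r)) ((0 : ℝ), (1 : ℝ)) r :=
      (hasDerivAt_const _ _).prodMk (hasDerivAt_id _)
    exact h1.comp_hasDerivAt r h2

/-- Integrals of smooth integrands form a class closed under differentiation, so the coinductive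
principle for smooth curves applies. -/
theorem contDiff_integral {H : ℝ × ℝ → ℝ} (hH : ContDiff ℝ ∞ H) :
    ContDiff ℝ ∞ fun s => ∫ u in (0 : ℝ)..1, H (u, s) := by
  refine IsSmoothCurve.contDiff (IsSmoothCurve.of_mem (M := {f | ∃ H : ℝ × ℝ → ℝ,
    ContDiff ℝ ∞ H ∧ f = fun s => ∫ u in (0 : ℝ)..1, H (u, s)}) ?_ ⟨H, hH, rfl⟩)
  rintro _ ⟨H, hH, rfl⟩
  refine ⟨_, ⟨fun q => fderiv ℝ H q (0, 1), ?_, rfl⟩, hasDerivAt_integral_of_contDiff hH⟩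
  exact (hH.fderiv_right (m := ∞) (by simp)).clm_apply contDiff_const

end ParametricIntegral

/-! ### Star-shaped neighbourhoods and the mean value formula -/

section RadialMean

set_option linter.unusedSectionVars false

variable {E : Type*} [AddCommGroup E] [Module ℝ E] [TopologicalSpace E]
  [IsTopologicalAddGroup E] [ContinuousSMul ℝ E]

/-- `U` is star-shaped with respect to `a`. -/
def IsRadial (a : E) (U : Set E) : Prop :=
  ∀ x ∈ U, ∀ t ∈ Set.Icc (0 : ℝ) 1, a + t • (x - a) ∈ U

/-- Every `c^∞`-open neighbourhood contains a star-shaped one. -/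
theorem IsCInftyNhd.exists_radial {a : E} {U : Set E} (hU : IsCInftyNhd a U) :
    ∃ W ⊆ U, IsCInftyNhd a W ∧ IsRadial a W := by
  refine ⟨{x | ∀ t ∈ Set.Icc (0 : ℝ) 1, a + t • (x - a) ∈ U}, fun x hx => ?_, ⟨?_, ?_⟩, ?_⟩
  · simpa using hx 1 (by simp)
  · rw [isOpen_cInfty_iff]
    intro c hc
    let P : ℝ × ℝ → E := fun q => a + q.1 • (c q.2 - a)
    have hP : CurveSmooth P := fun γ hγ => (isSmoothCurve_const a).add
      (IsSmoothCurve.smul_comp hγ.fst contDiff_id ((hc.comp hγ.snd).sub_const a))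
    have hW := hP.isOpen_preimage hU.1
    rw [isOpen_iff_mem_nhds]
    intro s hs
    -- Tube lemma: compactness of `[0, 1]` makes the condition on the whole segment open in `s`.
    refine isCompact_Icc.eventually_forall_of_forall_eventually fun t ht => ?_
    have h1 : (t, s) ∈ P ⁻¹' U := hs t ht
    have h2 : Tendsto (fun q : ℝ × ℝ => (q.2, q.1)) (𝓝 (s, t)) (𝓝 (t, s)) :=
      (continuous_swap (X := ℝ) (Y := ℝ)).tendsto (s, t)
    exact h2.eventually (hW.mem_nhds h1)
  · intro t _
    simpa using hU.2
  · intro x hx t ht r hr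
    have e : a + r • (a + t • (x - a) - a) = a + (r * t) • (x - a) := by
      rw [add_sub_cancel_left, smul_smul]
    rw [e]
    exact hx _ ⟨mul_nonneg hr.1 ht.1, mul_le_one₀ hr.2 ht.1 ht.2⟩

open Real (smoothTransition)

/-- The mean of the directional derivatives of `f` in direction `y` over the segment from
`a` to `x`. -/
noncomputable def radialMean (f : E → ℝ) (a x y : E) : ℝ :=
  ∫ u in (0 : ℝ)..1, deriv smoothTransition u * dirDeriv f (a + smoothTransition u • (x - a)) y

variable {a : E} {U : Set E} {f : E → ℝ}

theorem contDiff_deriv_smoothTransition : ContDiff ℝ ∞ (deriv smoothTransition) :=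
  (contDiff_infty_iff_deriv.1 Real.smoothTransition.contDiff).2

/-- This is the reason for the parametrization by `smoothTransition`: the point stays in `U` for
every real `u`, so the integrand is smooth on all of `ℝ × ℝ`. -/
theorem IsRadial.smoothTransition_mem (hUr : IsRadial a U) {x : E} (hx : x ∈ U) (u : ℝ) :
    a + smoothTransition u • (x - a) ∈ U :=
  hUr x hx _ ⟨Real.smoothTransition.nonneg u, Real.smoothTransition.le_one u⟩

theorem contDiff_radialMean_integrand (hf : IsSmoothOn U f) (hU : IsOpen[cInftyTopology E] U)
    (hUr : IsRadial a U) {c v : ℝ → E} (hc : IsSmoothCurve c) (hcU : ∀ s, c s ∈ U)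
    (hv : IsSmoothCurve v) : ContDiff ℝ ∞ fun q : ℝ × ℝ => deriv smoothTransition q.1 *
      dirDeriv f (a + smoothTransition q.1 • (c q.2 - a)) (v q.2) := by
  have hσ : ContDiff ℝ ∞ smoothTransition := Real.smoothTransition.contDiff
  have hP : CurveSmooth fun q : ℝ × ℝ => a + smoothTransition q.1 • (c q.2 - a) := fun γ hγ =>
    (isSmoothCurve_const a).add
      (IsSmoothCurve.smul_comp (hσ.comp hγ.fst) contDiff_id ((hc.comp hγ.snd).sub_const a))
  have hQ : CurveSmooth fun q : ℝ × ℝ => v q.2 := fun γ hγ => hv.comp hγ.snd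
  refine (contDiff_deriv_smoothTransition.comp contDiff_fst).mul ?_
  rw [contDiff_iff_contDiffAt]
  intro q
  exact hf.contDiffAt_dirDeriv hU hP hQ (hUr.smoothTransition_mem (hcU q.2) q.1)

theorem contDiff_radialMean (hf : IsSmoothOn U f) (hU : IsOpen[cInftyTopology E] U)
    (hUr : IsRadial a U) {c v : ℝ → E} (hc : IsSmoothCurve c) (hcU : ∀ s, c s ∈ U)
    (hv : IsSmoothCurve v) : ContDiff ℝ ∞ fun s => radialMean f a (c s) (v s) :=
  contDiff_integral (contDiff_radialMean_integrand hf hU hUr hc hcU hv)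

theorem continuous_radialMean_integrand (hf : IsSmoothOn U f) (hU : IsOpen[cInftyTopology E] U)
    (hUr : IsRadial a U) {x : E} (hx : x ∈ U) (y : E) : Continuous fun u =>
      deriv smoothTransition u * dirDeriv f (a + smoothTransition u • (x - a)) y :=
  (contDiff_radialMean_integrand hf hU hUr (isSmoothCurve_const x) (fun _ => hx)
    (isSmoothCurve_const y)).continuous.comp (by fun_prop : Continuous fun u : ℝ => (u, (0 : ℝ)))

theorem radialMean_linear (hf : IsSmoothOn U f) (hU : IsOpen[cInftyTopology E] U)
    (hUr : IsRadial a U) {x : E} (hx : x ∈ U) (v w : E) (s r : ℝ) :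
    radialMean f a x (s • v + r • w) = s * radialMean f a x v + r * radialMean f a x w := by
  have hi := fun y =>
    (continuous_radialMean_integrand hf hU hUr hx y).intervalIntegrable (μ := MeasureTheory.volume)
      0 1
  simp only [radialMean]
  rw [← intervalIntegral.integral_const_mul, ← intervalIntegral.integral_const_mul,
    ← intervalIntegral.integral_add ((hi v).const_mul s) ((hi w).const_mul r)]
  congr 1
  ext u
  rw [hf.dirDeriv_linear hU (hUr.smoothTransition_mem hx u)]
  ring

/-- The weight `deriv smoothTransition` has integral `1` over `[0, 1]`. -/
theorem radialMean_self (y : E) : radialMean f a a y = dirDeriv f a y := by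
  have hσ : ContDiff ℝ ∞ smoothTransition := Real.smoothTransition.contDiff
  simp only [radialMean, sub_self, smul_zero, add_zero]
  rw [intervalIntegral.integral_mul_const, intervalIntegral.integral_deriv_eq_sub]
  · simp
  · exact fun u _ => hσ.differentiable (by simp) u
  · exact contDiff_deriv_smoothTransition.continuous.intervalIntegrable _ _

/-- Mean value formula along the segment from `a` to `x`. -/
theorem radialMean_sub (hf : IsSmoothOn U f) (hU : IsOpen[cInftyTopology E] U)
    (hUr : IsRadial a U) {x : E} (hx : x ∈ U) : radialMean f a x (x - a) = f x - f a := by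
  have hσ : ContDiff ℝ ∞ smoothTransition := Real.smoothTransition.contDiff
  have h : ∀ u, HasDerivAt (fun u => f (a + smoothTransition u • (x - a)))
      (deriv smoothTransition u * dirDeriv f (a + smoothTransition u • (x - a)) (x - a)) u := by
    intro u
    have h1 := hf.hasDerivAt_dirDeriv hU (hUr.smoothTransition_mem hx u) (x - a)
    have h2 : HasDerivAt (fun r => smoothTransition r - smoothTransition u)
        (deriv smoothTransition u) u :=
      (hσ.differentiable (by simp) u).hasDerivAt.sub_const _
    have h3 := HasDerivAt.scomp u (by simpa using h1) h2
    refine h3.congr_of_eventuallyEq (Eventually.of_forall fun r => ?_)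
    simp only [Function.comp_apply]
    congr 1
    module
  rw [radialMean, intervalIntegral.integral_eq_sub_of_hasDerivAt (fun u _ => h u)
    ((continuous_radialMean_integrand hf hU hUr hx (x - a)).intervalIntegrable _ _)]
  simp

end RadialMean

/-! ### Smooth kernels and bounded sets of operators -/

section Kernels

set_option linter.unusedSectionVars false

variable {E : Type*} [AddCommGroup E] [Module ℝ E] [TopologicalSpace E]
  [IsTopologicalAddGroup E] [ContinuousSMul ℝ E]

/-- A function of `x ∈ U` and `y ∈ E` that is bounded linear in `y` and smooth along smooth
curves. -/
structure IsSmoothKernel (U : Set E) (G : E → E → ℝ) : Prop where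
  linear : ∀ x ∈ U, ∃ ψ : BDual E, ∀ y, G x y = ψ.1 y
  smooth : ∀ c v : ℝ → E, IsSmoothCurve c → (∀ s, c s ∈ U) → IsSmoothCurve v →
    ContDiff ℝ ∞ fun s => G (c s) (v s)

variable {a : E} {U : Set E} {G : E → E → ℝ}

theorem IsSmoothKernel.isSmoothOn_apply (hG : IsSmoothKernel U G) (y : E) :
    IsSmoothOn U fun x => G x y :=
  fun c hc hcU => hG.smooth c _ hc hcU (isSmoothCurve_const y)

variable [LocallyConvexSpace ℝ E]

theorem isSmoothKernel_radialMean [T2Space E] (hE : IsConvenient E) {f : E → ℝ}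
    (hf : IsSmoothOn U f)
    (hU : IsOpen[cInftyTopology E] U) (hUr : IsRadial a U) :
    IsSmoothKernel U (radialMean f a) := by
  refine ⟨fun x hx => ?_, fun c v hc hcU hv => contDiff_radialMean hf hU hUr hc hcU hv⟩
  let ℓ : E →ₗ[ℝ] ℝ :=
    { toFun := radialMean f a x
      map_add' := fun v w => by simpa using radialMean_linear hf hU hUr hx v w 1 1
      map_smul' := fun s v => by simpa using radialMean_linear hf hU hUr hx v 0 s 0 }
  exact ⟨⟨ℓ, mem_bdual_of_continuous_comp hE ℓ fun c hc =>
    (contDiff_radialMean hf hU hUr (isSmoothCurve_const x) (fun _ => hx) hc).continuous⟩,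
    fun y => rfl⟩

theorem BDual.contDiff_comp (ψ : BDual E) {c : ℝ → E} (hc : IsSmoothCurve c) :
    ContDiff ℝ ∞ fun s => ψ.1 (c s) :=
  (hc.boundedLinear_comp ψ).contDiff

theorem isSmoothKernel_bdual (ψ : BDual E) : IsSmoothKernel U fun _ y => ψ.1 y :=
  ⟨fun _ _ => ⟨ψ, fun _ => rfl⟩, fun _ _ _ _ hv => BDual.contDiff_comp ψ hv⟩

theorem IsSmoothKernel.sub {G' : E → E → ℝ} (hG : IsSmoothKernel U G)
    (hG' : IsSmoothKernel U G') : IsSmoothKernel U fun x y => G x y - G' x y := by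
  refine ⟨fun x hx => ?_, fun c v hc hcU hv =>
    (hG.smooth c v hc hcU hv).sub (hG'.smooth c v hc hcU hv)⟩
  obtain ⟨ψ, hψ⟩ := hG.linear x hx
  obtain ⟨ψ', hψ'⟩ := hG'.linear x hx
  exact ⟨ψ - ψ', fun y => by simp [hψ, hψ']⟩

/-- The function `x ↦ G x (A (x - a))`. -/
def kernelFun (G : E → E → ℝ) (a : E) (A : BoundedLinear E E) (x : E) : ℝ :=
  G x (A.1 (x - a))

theorem IsSmoothKernel.isSmoothOn (hG : IsSmoothKernel U G) (a : E) (A : BoundedLinear E E) :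
    IsSmoothOn U (kernelFun G a A) :=
  fun c hc hcU => hG.smooth c _ hc hcU ((hc.sub_const a).boundedLinear_comp A)

/-- A bounded functional is continuous on continuous linear images of normed spaces. -/
theorem BDual.continuous_comp_clm {X : Type*} [NormedAddCommGroup X] [NormedSpace ℝ X]
    (ψ : BDual E) (S : X →L[ℝ] E) : Continuous fun x => ψ.1 (S x) := by
  have hb : Bornology.IsVonNBounded ℝ (S '' Metric.closedBall 0 1) :=
    (NormedSpace.isVonNBounded_closedBall ℝ X 1).image S
  obtain ⟨C, hC⟩ := (NormedSpace.isVonNBounded_iff' ℝ).1 (ψ.2 _ hb)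
  refine AddMonoidHomClass.continuous_of_bound (ψ.1.comp S.toLinearMap) (C / 1)
    (LinearMap.bound_of_ball_bound' one_pos C _ fun z hz => ?_)
  exact hC _ ⟨S z, ⟨z, hz, rfl⟩, rfl⟩

/-- This gives boundedness of the functional `Λ` on operators. A violating sequence `A n` is summed
to operators `∑ 2⁻ⁿ bₙ A n`; uniform boundedness in `b` then controls all `A n` at once through the
unit sequences. -/
theorem IsSmoothKernel.isBoundedSmooth [T2Space E] (hE : IsConvenient E)
    (hG : IsSmoothKernel U G) (a : E) {H : Set (BoundedLinear E E)} (hH : IsBoundedMaps H) :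
    IsBoundedSmooth U (kernelFun G a '' H) := by
  refine ⟨?_, fun c hc hcU k K hK => ?_⟩
  · rintro _ ⟨A, -, rfl⟩
    exact hG.isSmoothOn a A
  rw [isBounded_iff_forall_norm_le]
  by_contra! hcon
  have : ∀ n : ℕ, ∃ A ∈ H, ∃ s ∈ K,
      n * 2 ^ n < |iteratedDeriv k (kernelFun G a A ∘ c) s| := by
    intro n
    obtain ⟨_, ⟨_, ⟨A, hA, rfl⟩, s, hs, rfl⟩, h⟩ := hcon (n * 2 ^ n)
    exact ⟨A, hA, s, hs, h⟩
  choose A hA s hs hAs using this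
  have hAb : IsBoundedMaps (Set.range A) := by
    intro B hB
    refine (hH B hB).subset ?_
    rintro _ ⟨_, ⟨n, rfl⟩, x, hx, rfl⟩
    exact ⟨A n, hA n, x, hx, rfl⟩
  obtain ⟨S, hS, hSc⟩ := exists_sumOperator hE hAb
  choose ψ hψ using fun s => hG.linear (c s) (hcU s)
  let T : BddSeq →ₗ[ℝ] ℝ → ℝ :=
    { toFun := fun b s => kernelFun G a (S b) (c s)
      map_add' := fun b b' => by
        ext s
        simp [kernelFun, hψ]
      map_smul' := fun r b => by
        ext s
        simp [kernelFun, hψ] }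
  have hTc : ∀ s, Continuous fun b => T b s := by
    intro s
    let R : BddSeq →L[ℝ] E :=
      ⟨(LinearMap.applyₗ (c s - a)).comp ((BoundedLinear E E).subtype.comp S), hSc _⟩
    have := BDual.continuous_comp_clm (ψ s) R
    refine this.congr fun b => ?_
    exact (hψ s _).symm
  obtain ⟨C, hC⟩ := exists_iteratedDeriv_le T hTc (fun b => hG.isSmoothOn a (S b) c hc hcU) k hK
  have hTn : ∀ n, T (unitSeq n) = (1 / 2 : ℝ) ^ n • (kernelFun G a (A n) ∘ c) := by
    intro n
    ext s
    simp [T, hS, kernelFun, hψ, mul_sub]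
  obtain ⟨n, hn⟩ := exists_nat_gt |C|
  have h1 := hC (unitSeq n) (s n) (hs n)
  rw [hTn, iteratedDeriv_const_smul_field, smul_eq_mul, abs_mul,
    abs_of_pos (by positivity : (0 : ℝ) < (1 / 2) ^ n)] at h1
  have h2 : C * ‖unitSeq n‖ ≤ |C| :=
    (mul_le_mul_of_nonneg_right (le_abs_self C) (norm_nonneg _)).trans
      (mul_le_of_le_one_right (abs_nonneg C) (norm_unitSeq_le n))
  -- The threshold `n * 2 ^ n` was chosen to absorb the weight `2⁻ⁿ` carried by the unit sequence.
  have h3 : (n : ℝ) < (1 / 2) ^ n * |iteratedDeriv k (kernelFun G a (A n) ∘ c) (s n)| := by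
    calc (n : ℝ) = (1 / 2) ^ n * (n * 2 ^ n) := by
          rw [mul_left_comm, ← mul_pow]; norm_num
      _ < _ := by have := hAs n; gcongr
  linarith

end Kernels

/-! ### Differentials of germs and the maps between `E''` and tangent vectors -/

section Germs

set_option linter.unusedSectionVars false

variable {E : Type*} [AddCommGroup E] [Module ℝ E] [TopologicalSpace E]
  [IsTopologicalAddGroup E] [ContinuousSMul ℝ E] {a : E} {U V W : Set E} {f g : E → ℝ}

theorem IsCInftyNhd.mem_nhds (hW : IsCInftyNhd a W) : W ∈ @nhds E (cInftyTopology E) a :=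
  @IsOpen.mem_nhds E (cInftyTopology E) a W hW.1 hW.2

theorem isCInftyNhd_univ : IsCInftyNhd a (Set.univ : Set E) :=
  ⟨@isOpen_univ E (cInftyTopology E), trivial⟩

theorem germOf_congr (hU : IsCInftyNhd a U) (hV : IsCInftyNhd a V) (hf : IsSmoothOn U f)
    (hg : IsSmoothOn V g) (hW : IsCInftyNhd a W) (h : ∀ x ∈ W, f x = g x) :
    germOf hU f hf = germOf hV g hg :=
  Subtype.ext (Filter.Germ.coe_eq.2 (mem_of_superset hW.mem_nhds h))

theorem SmoothGerms.exists_eq_germOf (g : SmoothGerms a) :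
    ∃ (U : Set E) (hU : IsCInftyNhd a U) (f : E → ℝ) (hf : IsSmoothOn U f), g = germOf hU f hf := by
  obtain ⟨_, U, hU, f, hf, rfl⟩ := g
  exact ⟨U, hU, f, hf, rfl⟩

theorem evalGerm_germOf (hU : IsCInftyNhd a U) (hf : IsSmoothOn U f) :
    evalGerm (germOf hU f hf) = f a := rfl

theorem IsSmoothOn.mono (hf : IsSmoothOn U f) (h : V ⊆ U) : IsSmoothOn V f :=
  fun c hc hcV => hf c hc fun t => h (hcV t)

theorem IsSmoothOn.add (hf : IsSmoothOn U f) (hg : IsSmoothOn U g) :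
    IsSmoothOn U fun x => f x + g x :=
  fun c hc hcU => (hf c hc hcU).add (hg c hc hcU)

theorem IsSmoothOn.mul (hf : IsSmoothOn U f) (hg : IsSmoothOn U g) :
    IsSmoothOn U fun x => f x * g x :=
  fun c hc hcU => (hf c hc hcU).mul (hg c hc hcU)

theorem isSmoothOn_const (r : ℝ) : IsSmoothOn U fun _ => r :=
  fun _ _ _ => contDiff_const

/-- Lines through `a` are smooth curves, so they remain for a short time in any `c^∞`-open
neighbourhood; differentials therefore depend only on germs. -/
theorem IsDifferential.congr {φ : BDual E} (h : IsDifferential f a φ)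
    (hfg : f =ᶠ[@nhds E (cInftyTopology E) a] g) : IsDifferential g a φ := by
  intro v
  obtain ⟨W, hW, hWo, haW⟩ := (@mem_nhds_iff E (cInftyTopology E) a _).1 hfg
  refine (h v).congr_of_eventuallyEq ?_
  have hc : IsSmoothCurve fun t : ℝ => a + t • v :=
    (isSmoothCurve_const a).add (isSmoothCurve_smul_const contDiff_id v)
  have h0 : (0 : ℝ) ∈ (fun t : ℝ => a + t • v) ⁻¹' W := by simpa using haW
  filter_upwards [(isOpen_cInfty_iff.1 hWo _ hc).mem_nhds h0] with t ht
  exact (hW ht).symm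

theorem IsDifferential.add {φ ψ : BDual E} (hf : IsDifferential f a φ)
    (hg : IsDifferential g a ψ) : IsDifferential (fun x => f x + g x) a (φ + ψ) :=
  fun v => (hf v).add (hg v)

theorem IsDifferential.const_mul {φ : BDual E} (hf : IsDifferential f a φ) (r : ℝ) :
    IsDifferential (fun x => r * f x) a (r • φ) :=
  fun v => (hf v).const_mul r

theorem IsDifferential.mul {φ ψ : BDual E} (hf : IsDifferential f a φ)
    (hg : IsDifferential g a ψ) :
    IsDifferential (fun x => f x * g x) a (g a • φ + f a • ψ) := by
  intro v
  refine ((hf v).mul (hg v)).congr_deriv ?_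
  simp
  ring

theorem isDifferential_bdual (φ : BDual E) : IsDifferential (fun x => φ.1 (x - a)) a φ := by
  intro v
  simpa using (hasDerivAt_id (0 : ℝ)).mul_const (φ.1 v)

variable [LocallyConvexSpace ℝ E] [T2Space E]

theorem exists_isDifferential_germ (hE : IsConvenient E) (g : SmoothGerms a) :
    ∃ φ : BDual E, ∀ f : E → ℝ, (f : GermAt a) = g.1 → IsDifferential f a φ := by
  obtain ⟨U, hU, f, hf, rfl⟩ := SmoothGerms.exists_eq_germOf g
  obtain ⟨φ, hφ⟩ := hf.exists_isDifferential hE hU.1 hU.2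
  exact ⟨φ, fun g hg => hφ.congr (Filter.Germ.coe_eq.1 hg.symm)⟩

theorem germDifferential_aux (hE : IsConvenient E) {g : SmoothGerms a} {f : E → ℝ}
    (hf : (f : GermAt a) = g.1) {φ : BDual E} (hφ : IsDifferential f a φ) :
    (exists_isDifferential_germ hE g).choose = φ :=
  ((exists_isDifferential_germ hE g).choose_spec f hf).unique hφ

/-- The differential at `a` of germs at `a` of smooth functions. -/
noncomputable def germDifferential (hE : IsConvenient E) (a : E) :
    SmoothGerms a →ₗ[ℝ] BDual E where
  toFun g := (exists_isDifferential_germ hE g).choose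
  map_add' := by
    intro g h
    obtain ⟨U, hU, f, hf, rfl⟩ := SmoothGerms.exists_eq_germOf g
    obtain ⟨V, hV, k, hk, rfl⟩ := SmoothGerms.exists_eq_germOf h
    exact germDifferential_aux hE (f := fun x => f x + k x) rfl
      (((exists_isDifferential_germ hE _).choose_spec f rfl).add
        ((exists_isDifferential_germ hE _).choose_spec k rfl))
  map_smul' := by
    intro r g
    obtain ⟨U, hU, f, hf, rfl⟩ := SmoothGerms.exists_eq_germOf g
    exact germDifferential_aux hE (f := fun x => r * f x) rfl
      (((exists_isDifferential_germ hE _).choose_spec f rfl).const_mul r)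

theorem isDifferential_germDifferential (hE : IsConvenient E) (hU : IsCInftyNhd a U)
    (hf : IsSmoothOn U f) : IsDifferential f a (germDifferential hE a (germOf hU f hf)) :=
  (exists_isDifferential_germ hE (germOf hU f hf)).choose_spec f rfl

theorem germDifferential_mul (hE : IsConvenient E) (g h : SmoothGerms a) :
    germDifferential hE a ⟨g.1 * h.1, SmoothGerms.mul_mem g.2 h.2⟩ =
      evalGerm h • germDifferential hE a g + evalGerm g • germDifferential hE a h := by
  obtain ⟨U, hU, f, hf, rfl⟩ := SmoothGerms.exists_eq_germOf g
  obtain ⟨V, hV, k, hk, rfl⟩ := SmoothGerms.exists_eq_germOf h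
  exact germDifferential_aux hE (f := fun x => f x * k x) rfl
    ((isDifferential_germDifferential hE hU hf).mul (isDifferential_germDifferential hE hV hk))

/-- The differentials of a bounded set of smooth functions form a bounded subset of `E'`. -/
theorem IsBoundedSmooth.isBoundedMaps (hE : IsConvenient E) (hU : IsCInftyNhd a U)
    {𝓕 : Set (E → ℝ)} (h𝓕 : IsBoundedSmooth U 𝓕) :
    IsBoundedMaps {φ : BDual E | ∃ (f : E → ℝ) (hf : f ∈ 𝓕),
      φ = germDifferential hE a (germOf hU f (h𝓕.1 f hf))} := by
  intro B hB
  obtain ⟨C, hC⟩ := h𝓕.exists_dirDeriv_le hE hU hB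
  rw [NormedSpace.isVonNBounded_iff' ℝ]
  refine ⟨C, ?_⟩
  rintro _ ⟨_, ⟨f, hf, rfl⟩, v, hv, rfl⟩
  rw [(isDifferential_germDifferential hE hU (h𝓕.1 f hf)).apply_eq_dirDeriv]
  exact hC f hf v hv

/-- The operational tangent vector induced by an element of the bidual. -/
noncomputable def tangentOfBidual (hE : IsConvenient E) (a : E) (Y : BBidual E) :
    OperationalTangent a :=
  ⟨Y.1.comp (germDifferential hE a), by
    refine ⟨fun g h => ?_, fun U hU 𝓕 h𝓕 => ?_⟩
    · simp only [LinearMap.comp_apply, germDifferential_mul, map_add, map_smul, smul_eq_mul]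
      ring
    · refine (Y.2 _ (h𝓕.isBoundedMaps hE hU)).subset ?_
      rintro _ ⟨f, hf, rfl⟩
      exact ⟨_, ⟨f, hf, rfl⟩, rfl⟩⟩

theorem isInducedBy_tangentOfBidual (hE : IsConvenient E) (Y : BBidual E) :
    IsInducedBy (tangentOfBidual hE a Y) Y :=
  fun _ hU _ hf => ⟨_, isDifferential_germDifferential hE hU hf, rfl⟩

theorem isSmoothOn_bdual (φ : BDual E) : IsSmoothOn U fun x => φ.1 (x - a) :=
  fun _ hc _ => BDual.contDiff_comp φ (hc.sub_const a)

/-- The germ at `a` of the affine function with linear part `φ` vanishing at `a`. -/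
noncomputable def linearGerm (a : E) (φ : BDual E) : SmoothGerms a :=
  germOf isCInftyNhd_univ (fun x => φ.1 (x - a)) (isSmoothOn_bdual φ)

theorem germDifferential_linearGerm (hE : IsConvenient E) (φ : BDual E) :
    germDifferential hE a (linearGerm a φ) = φ :=
  (isDifferential_germDifferential hE _ _).unique (isDifferential_bdual φ)

theorem BDual.iteratedDeriv_comp (k : ℕ) {d : ℕ → ℝ → E}
    (hd : ∀ n t, HasDerivAt (d n) (d (n + 1) t) t) (φ : BDual E) :
    iteratedDeriv k (fun t => φ.1 (d 0 t)) = fun t => φ.1 (d k t) := by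
  induction k with
  | zero => simp
  | succ k ih =>
    rw [iteratedDeriv_succ, ih]
    ext t
    have hc : Continuous (d (k + 2)) :=
      IsSmoothCurve.continuous ⟨fun n => d (n + (k + 2)), by simp, fun n t => by
        have := hd (n + (k + 2)) t
        rwa [add_right_comm] at this⟩
    exact (hasDerivAt_boundedLinear_comp φ (hd k) (hd (k + 1)) hc t).deriv

/-- Bounded subsets of `E'` define bounded sets of smooth functions. -/
theorem IsBoundedMaps.isBoundedSmooth {H : Set (BDual E)} (hH : IsBoundedMaps H) (a : E) :
    IsBoundedSmooth (Set.univ : Set E) ((fun (φ : BDual E) x => φ.1 (x - a)) '' H) := by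
  refine ⟨?_, fun c hc _ k K hK => ?_⟩
  · rintro _ ⟨φ, -, rfl⟩
    exact isSmoothOn_bdual φ
  · obtain ⟨d, hd0, hd⟩ := hc.sub_const a
    have hk : IsSmoothCurve (d k) := ⟨fun n => d (n + k), by simp, fun n t => by
      have := hd (n + k) t
      rwa [add_right_comm] at this⟩
    have := hH _ (hk.isVonNBounded_image hK)
    rw [NormedSpace.isVonNBounded_iff] at this
    refine this.subset ?_
    rintro _ ⟨_, ⟨φ, hφ, rfl⟩, t, ht, rfl⟩
    refine ⟨φ, hφ, d k t, ⟨t, ht, rfl⟩, ?_⟩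
    have := BDual.iteratedDeriv_comp k hd φ
    rw [hd0] at this
    exact congrFun this t

/-- The element of the bidual obtained by restricting an operational tangent vector to affine
functions. -/
noncomputable def bidualOfTangent {a : E} (D : OperationalTangent a) : BBidual E :=
  ⟨{ toFun := fun φ => D.1 (linearGerm a φ)
     map_add' := fun φ ψ => by
      rw [← map_add]
      rfl
     map_smul' := fun r φ => by
      rw [RingHom.id_apply, ← map_smul]
      rfl }, by
    intro H hH
    refine (D.2.2 Set.univ isCInftyNhd_univ _ (hH.isBoundedSmooth a)).subset ?_
    rintro _ ⟨φ, hφ, rfl⟩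
    exact ⟨_, ⟨φ, hφ, rfl⟩, rfl⟩⟩

end Germs

/-! ### Tangent vectors are of first order -/

section Derivations

set_option linter.unusedSectionVars false

variable {E : Type*} [AddCommGroup E] [Module ℝ E] [TopologicalSpace E]
  [IsTopologicalAddGroup E] [ContinuousSMul ℝ E] [LocallyConvexSpace ℝ E] [T2Space E]
  {a : E} {U : Set E} {f : E → ℝ}

theorem OperationalTangent.apply_const (D : OperationalTangent a) (hU : IsCInftyNhd a U) (r : ℝ) :
    D.1 (germOf hU (fun _ => r) (isSmoothOn_const r)) = 0 := by
  have h1 : D.1 (germOf hU (fun _ => 1) (isSmoothOn_const 1)) = 0 := by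
    have := D.2.1 (germOf hU (fun _ => 1) (isSmoothOn_const 1))
      (germOf hU (fun _ => 1) (isSmoothOn_const 1))
    have e : (⟨(germOf hU (fun _ => (1 : ℝ)) (isSmoothOn_const 1)).1 *
        (germOf hU (fun _ => (1 : ℝ)) (isSmoothOn_const 1)).1, SmoothGerms.mul_mem
        (germOf hU (fun _ => (1 : ℝ)) (isSmoothOn_const 1)).2
        (germOf hU (fun _ => (1 : ℝ)) (isSmoothOn_const 1)).2⟩ : SmoothGerms a) =
        germOf hU (fun _ => 1) (isSmoothOn_const 1) :=
      Subtype.ext (mul_one _)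
    rw [e, evalGerm_germOf] at this
    linarith
  have h2 : germOf hU (fun _ => r) (isSmoothOn_const r) =
      r • germOf hU (fun _ => 1) (isSmoothOn_const 1) :=
    germOf_congr (f := fun _ => r) (g := fun _ => r * 1) hU hU _
      (fun _ _ _ => contDiff_const) hU fun _ _ => (mul_one r).symm
  rw [h2, map_smul, h1, smul_zero]

/-- The functional `A ↦ D (x ↦ G x (A (x - a)))` on operators. -/
noncomputable def kernelFunctional (D : OperationalTangent a) (hU : IsCInftyNhd a U)
    {G : E → E → ℝ} (hG : IsSmoothKernel U G) : BoundedLinear E E →ₗ[ℝ] ℝ where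
  toFun A := D.1 (germOf hU (kernelFun G a A) (hG.isSmoothOn a A))
  map_add' A B := by
    rw [← map_add]
    congr 1
    refine germOf_congr (g := fun x => kernelFun G a A x + kernelFun G a B x) hU hU _
      ((hG.isSmoothOn a A).add (hG.isSmoothOn a B)) hU fun x hx => ?_
    obtain ⟨ψ, hψ⟩ := hG.linear x hx
    simp [kernelFun, hψ]
  map_smul' r A := by
    rw [RingHom.id_apply, ← map_smul]
    congr 1
    refine germOf_congr (g := fun x => r * kernelFun G a A x) hU hU _
      ((isSmoothOn_const r).mul (hG.isSmoothOn a A)) hU fun x hx => ?_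
    obtain ⟨ψ, hψ⟩ := hG.linear x hx
    simp [kernelFun, hψ, mul_sub]

/-- For `A x = φ x • y` the function is `φ (x - a) * G x y`, a product of two factors vanishing at
`a`, which a derivation annihilates. -/
theorem kernelFunctional_eq_zero_of_mem_finiteRankMaps (D : OperationalTangent a)
    (hU : IsCInftyNhd a U) {G : E → E → ℝ} (hG : IsSmoothKernel U G) (hGa : ∀ y, G a y = 0)
    {A : BoundedLinear E E} (hA : A ∈ finiteRankMaps E) : kernelFunctional D hU hG A = 0 := by
  induction hA using Submodule.span_induction with
  | zero => simp
  | add A B _ _ hA hB => rw [map_add, hA, hB, add_zero]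
  | smul r A _ hA => rw [map_smul, hA, smul_zero]
  | mem A hA =>
    obtain ⟨φ, y, hA⟩ := hA
    have hm := D.2.1 (germOf hU (fun x => φ.1 (x - a)) (isSmoothOn_bdual φ))
      (germOf hU (fun x => G x y) (hG.isSmoothOn_apply y))
    rw [evalGerm_germOf, evalGerm_germOf, hGa, sub_self, map_zero, mul_zero, zero_mul,
      add_zero] at hm
    rw [← hm]
    change D.1 _ = D.1 _
    congr 1
    refine germOf_congr (g := fun x => φ.1 (x - a) * G x y) hU hU _
      ((isSmoothOn_bdual φ).mul (hG.isSmoothOn_apply y)) hU fun x hx => ?_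
    obtain ⟨ψ, hψ⟩ := hG.linear x hx
    simp [kernelFun, hψ, hA, -map_sub]

/-- The absolute value of the functional is a seminorm bounded on bounded sets, hence continuous for
the bornological topology. Vanishing on the dense subspace of finite-rank operators thus extends to
all operators. -/
theorem kernelFunctional_eq_zero (hE : IsConvenient E)
    (hAP : HasBornologicalApproximationProperty E) (D : OperationalTangent a)
    (hU : IsCInftyNhd a U) {G : E → E → ℝ} (hG : IsSmoothKernel U G) (hGa : ∀ y, G a y = 0)
    (A : BoundedLinear E E) : kernelFunctional D hU hG A = 0 := by
  let Λ := kernelFunctional D hU hG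
  let p : Seminorm ℝ (BoundedLinear E E) := (normSeminorm ℝ ℝ).comp Λ
  have hp : ∀ H : Set (BoundedLinear E E), IsBoundedMaps H → BddAbove (p '' H) := by
    intro H hH
    obtain ⟨C, hC⟩ := isBounded_iff_forall_norm_le.1
      (D.2.2 U hU _ (hG.isBoundedSmooth hE a hH))
    refine ⟨C, ?_⟩
    rintro _ ⟨A, hA, rfl⟩
    exact hC _ ⟨_, ⟨A, hA, rfl⟩, rfl⟩
  let P : SeminormFamily ℝ (BoundedLinear E E)
      {p : Seminorm ℝ (BoundedLinear E E) // ∀ H, IsBoundedMaps H → BddAbove (p '' H)} :=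
    fun p => p.1
  let _ : TopologicalSpace (BoundedLinear E E) := bornologicalTopology IsBoundedMaps
  have hP : WithSeminorms P := ⟨rfl⟩
  have key : ∀ ε > 0, |Λ A| < ε := by
    intro ε hε
    have hb : p.ball A ε ∈ 𝓝 A :=
      (hP.mem_nhds_iff A _).2 ⟨{⟨p, hp⟩}, ε, hε, by simp [P]⟩
    obtain ⟨B, hB, hBf⟩ := mem_closure_iff_nhds.1 (hAP A) _ hb
    have hB0 : Λ B = 0 := kernelFunctional_eq_zero_of_mem_finiteRankMaps D hU hG hGa hBf
    have h1 : p (B - A) < ε := hB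
    have h2 : p (B - A) = |Λ (B - A)| := rfl
    rwa [h2, map_sub, hB0, zero_sub, abs_neg] at h1
  by_contra h
  exact lt_irrefl _ (key _ (abs_pos.2 h))

/-- The identity as a bounded operator. -/
def boundedId (E : Type*) [AddCommGroup E] [Module ℝ E] [TopologicalSpace E]
    [IsTopologicalAddGroup E] [ContinuousSMul ℝ E] : BoundedLinear E E :=
  ⟨LinearMap.id, fun B hB => by simpa using hB⟩

/-- Operational tangent vectors are of first order. -/
theorem OperationalTangent.apply_germOf (hE : IsConvenient E)
    (hAP : HasBornologicalApproximationProperty E) (D : OperationalTangent a)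
    (hU : IsCInftyNhd a U) (hf : IsSmoothOn U f) {φ : BDual E} (hφ : IsDifferential f a φ) :
    D.1 (germOf hU f hf) = (bidualOfTangent D).1 φ := by
  obtain ⟨W, hWU, hW, hWr⟩ := hU.exists_radial
  have hfW := hf.mono hWU
  -- Subtracting `df(a)` from the radial mean makes the kernel vanish at `a`; the remainder of `f`
  -- is then the kernel function of the identity operator.
  have hG := (isSmoothKernel_radialMean hE hfW hW.1 hWr).sub (isSmoothKernel_bdual φ)
  have h0 := kernelFunctional_eq_zero hE hAP D hW hG (fun y => by
    rw [radialMean_self, hφ.apply_eq_dirDeriv, sub_self]) (boundedId E)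
  change D.1 _ = 0 at h0
  have e : germOf hU f hf = germOf hW _ (hG.isSmoothOn a (boundedId E)) +
      germOf hW (fun _ => f a) (isSmoothOn_const _) + linearGerm a φ := by
    refine germOf_congr (g := fun x => kernelFun _ a (boundedId E) x + f a + φ.1 (x - a)) hU hW hf
      (((hG.isSmoothOn a (boundedId E)).add (isSmoothOn_const _)).add (isSmoothOn_bdual φ))
      hW fun x hx => ?_
    change f x = radialMean f a x (x - a) - φ.1 (x - a) + f a + φ.1 (x - a)
    rw [radialMean_sub hfW hW.1 hWr hx]
    ring
  rw [e, map_add, map_add, h0, OperationalTangent.apply_const D hW, zero_add, zero_add]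
  rfl

/-- `E''` is isomorphic to the space of operational tangent vectors. -/
noncomputable def bidualEquivTangent (hE : IsConvenient E)
    (hAP : HasBornologicalApproximationProperty E) (a : E) :
    BBidual E ≃ₗ[ℝ] OperationalTangent a where
  toFun := tangentOfBidual hE a
  map_add' _ _ := rfl
  map_smul' _ _ := rfl
  invFun := bidualOfTangent
  left_inv Y := by
    ext φ
    change Y.1 (germDifferential hE a (linearGerm a φ)) = Y.1 φ
    rw [germDifferential_linearGerm]
  right_inv D := by
    refine Subtype.ext (LinearMap.ext fun g => ?_)
    obtain ⟨U, hU, f, hf, rfl⟩ := SmoothGerms.exists_eq_germOf g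
    exact (OperationalTangent.apply_germOf hE hAP D hU hf (isDifferential_germDifferential hE hU hf)).symm

/-- One direction holds because bounded families of functions have bounded differentials, the other
because bounded subsets of `E'` give bounded families of affine functions. -/
theorem isBoundedInBidual_iff (hE : IsConvenient E)
    (hAP : HasBornologicalApproximationProperty E) (S : Set (BBidual E)) :
    IsBoundedInBidual S ↔ IsBoundedTangent (bidualEquivTangent hE hAP a '' S) := by
  constructor
  · intro hS U hU 𝓕 h𝓕
    refine (hS _ (h𝓕.isBoundedMaps hE hU)).subset ?_
    rintro _ ⟨_, ⟨Y, hY, rfl⟩, f, hf, rfl⟩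
    exact ⟨Y, hY, _, ⟨f, hf, rfl⟩, rfl⟩
  · intro hS H hH
    refine (hS Set.univ isCInftyNhd_univ _ (hH.isBoundedSmooth a)).subset ?_
    rintro _ ⟨Y, hY, φ, hφ, rfl⟩
    refine ⟨_, ⟨Y, hY, rfl⟩, _, ⟨φ, hφ, rfl⟩, ?_⟩
    change Y.1 φ = Y.1 (germDifferential hE a (linearGerm a φ))
    rw [germDifferential_linearGerm]

end Derivations

/-! ### The canonical map into the bidual -/

section Reflexive

variable {E : Type*} [AddCommGroup E] [Module ℝ E] [TopologicalSpace E]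
  [IsTopologicalAddGroup E] [ContinuousSMul ℝ E] [LocallyConvexSpace ℝ E]

/-- Functionals dominated by a continuous seminorm are bounded. -/
theorem mem_bdual_of_abs_le {p : Seminorm ℝ E} (hp : Continuous p) {ℓ : E →ₗ[ℝ] ℝ}
    (h : ∀ y, |ℓ y| ≤ p y) : ℓ ∈ BDual E := by
  intro B hB
  obtain ⟨C, hC⟩ := isVonNBounded_iff_forall_seminorm.1 hB p hp
  rw [NormedSpace.isVonNBounded_iff' ℝ]
  refine ⟨C, ?_⟩
  rintro _ ⟨x, hx, rfl⟩
  exact (h x).trans (hC x hx)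

theorem isBoundedMaps_polar {p : Seminorm ℝ E} (hp : Continuous p) :
    IsBoundedMaps {φ : BDual E | ∀ y, |φ.1 y| ≤ p y} := by
  intro B hB
  obtain ⟨C, hC⟩ := isVonNBounded_iff_forall_seminorm.1 hB p hp
  rw [NormedSpace.isVonNBounded_iff' ℝ]
  refine ⟨C, ?_⟩
  rintro _ ⟨φ, hφ, x, hx, rfl⟩
  exact (hφ x).trans (hC x hx)

/-- The canonical map into the bidual. -/
def toBidual (E : Type*) [AddCommGroup E] [Module ℝ E] [TopologicalSpace E]
    [IsTopologicalAddGroup E] [ContinuousSMul ℝ E] : E →ₗ[ℝ] BBidual E where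
  toFun X := ⟨(LinearMap.applyₗ X).comp (BDual E).subtype, fun H hH => by
    have := hH {X} (Bornology.isVonNBounded_singleton X)
    rw [NormedSpace.isVonNBounded_iff] at this
    refine this.subset ?_
    rintro _ ⟨φ, hφ, rfl⟩
    exact ⟨φ, hφ, X, rfl, rfl⟩⟩
  map_add' X Y := by
    ext φ
    simp
  map_smul' r X := by
    ext φ
    simp

theorem toBidual_injective [T2Space E] : Function.Injective (toBidual E) := by
  rw [injective_iff_map_eq_zero]
  intro X hX
  by_contra h
  obtain ⟨⟨p, hp⟩, hpX⟩ := (PolynormableSpace.withSeminorms ℝ E).separating_of_T1 X h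
  obtain ⟨ℓ, h1, h2⟩ := exists_dual_eq_seminorm p X
  have h3 : (toBidual E X).1 ⟨ℓ, mem_bdual_of_abs_le hp h2⟩ = ℓ X := rfl
  rw [hX] at h3
  exact hpX (h1 ▸ h3.symm)

/-- For the converse, functionals dominated by a continuous seminorm `p` form a bounded subset of
`E'`, and by Hahn–Banach one of them attains `p X` at `X`. -/
theorem isVonNBounded_iff_toBidual (B : Set E) :
    Bornology.IsVonNBounded ℝ B ↔ IsBoundedInBidual (toBidual E '' B) := by
  constructor
  · intro hB H hH
    have := hH B hB
    rw [NormedSpace.isVonNBounded_iff] at this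
    refine this.subset ?_
    rintro _ ⟨_, ⟨X, hX, rfl⟩, φ, hφ, rfl⟩
    exact ⟨φ, hφ, X, hX, rfl⟩
  · intro hB
    rw [isVonNBounded_iff_forall_seminorm]
    intro p hp
    obtain ⟨C, hC⟩ := isBounded_iff_forall_norm_le.1 (hB _ (isBoundedMaps_polar hp))
    refine ⟨C, fun X hX => ?_⟩
    obtain ⟨ℓ, h1, h2⟩ := exists_dual_eq_seminorm p X
    have := hC _ ⟨toBidual E X, ⟨X, hX, rfl⟩, ⟨ℓ, mem_bdual_of_abs_le hp h2⟩, h2, rfl⟩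
    have h3 : (toBidual E X).1 ⟨ℓ, mem_bdual_of_abs_le hp h2⟩ = p X := h1
    rw [h3] at this
    exact (le_abs_self _).trans this

/-- The isomorphism of a reflexive space with its bidual. -/
noncomputable def bidualEquivOfReflexive [T2Space E] (hR : IsBReflexive E) :
    E ≃ₗ[ℝ] BBidual E :=
  LinearEquiv.ofBijective (toBidual E) ⟨toBidual_injective, fun Y => by
    obtain ⟨X, hX⟩ := hR Y
    refine ⟨X, Subtype.ext (LinearMap.ext fun φ => (hX φ).symm)⟩⟩

end Reflexive

end ConvenientCalculus

theorem mainTheorem7 (E : Type*) [AddCommGroup E] [Module ℝ E] [TopologicalSpace E]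
    [IsTopologicalAddGroup E] [ContinuousSMul ℝ E] [LocallyConvexSpace ℝ E] [T2Space E]
    (hE : ConvenientCalculus.IsConvenient E)
    (hAP : ConvenientCalculus.HasBornologicalApproximationProperty E) (a : E) :
    ConvenientCalculus.FirstOrderTangent a = Set.univ ∧
    (∃ Φ : ConvenientCalculus.BBidual E ≃ₗ[ℝ] ConvenientCalculus.OperationalTangent a,
      (∀ Y, ConvenientCalculus.IsInducedBy (Φ Y) Y) ∧
      (∀ S : Set (ConvenientCalculus.BBidual E),
        ConvenientCalculus.IsBoundedInBidual S ↔
          ConvenientCalculus.IsBoundedTangent (Φ '' S))) ∧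
    (ConvenientCalculus.IsBReflexive E →
      ∃ Ψ : E ≃ₗ[ℝ] ConvenientCalculus.OperationalTangent a,
        (∀ X, ConvenientCalculus.IsKinematic (Ψ X) X) ∧
        (∀ B : Set E, Bornology.IsVonNBounded ℝ B ↔
          ConvenientCalculus.IsBoundedTangent (Ψ '' B))) := by
  let Φ := ConvenientCalculus.bidualEquivTangent hE hAP a
  have hΦ : ∀ Y, ConvenientCalculus.IsInducedBy (Φ Y) Y :=
    ConvenientCalculus.isInducedBy_tangentOfBidual hE
  refine ⟨Set.eq_univ_of_forall fun D => ⟨Φ.symm D, ?_⟩,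
    ⟨Φ, hΦ, ConvenientCalculus.isBoundedInBidual_iff hE hAP⟩, fun hR => ?_⟩
  · have := hΦ (Φ.symm D)
    rwa [LinearEquiv.apply_symm_apply] at this
  · refine ⟨(ConvenientCalculus.bidualEquivOfReflexive hR).trans Φ, fun X U hU f hf => ?_,
      fun B => ?_⟩
    · obtain ⟨φ, hφ, h⟩ := hΦ (ConvenientCalculus.bidualEquivOfReflexive hR X) U hU f hf
      refine (hφ X).congr_deriv ?_
      exact h.symm
    · rw [ConvenientCalculus.isVonNBounded_iff_toBidual,
        ConvenientCalculus.isBoundedInBidual_iff hE hAP (a := a), Set.image_image]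
      rfl
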